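/- For every $n\in\mathbb N$, $\alpha>0$, $a\in\mathbb R$ and $\underline w>0$ there is a constant $C=C(n,\alpha,a,\underline w)>0$ with the following property. Let $T\in(0,\infty]$, let $\Omega\subset\mathbb R^n\times[0,T)$ be relatively open with slices $\Omega_t=\{x:(x,t)\in\Omega\}$, and let $u\colon\Omega\to[0,\infty)$ be continuous. Put $M_t=\operatorname{graph}u(\cdot,t)\subset\mathbb R^{n+1}$. Where $u(\cdot,t)$ is smooth, let $$w=\langle\nu,e_{n+1}\rangle=\frac1{\sqrt{1+|\nabla u|^2}},\qquad H=\operatorname{div}\left(\frac{\nabla u}{\sqrt{1+|\nabla u|^2}}\right)$$ be the vertical component of the upward unit normal $\nu$ and the mean curvature of $M_t$, and let $\psi=(a-u)_+$ be the height cut-off. Suppose that 1. for every $t\in[0,T)$ the set $\{x\in\Omega_t:u(x,t)\le a\}$ is compact, and $\{(x,t)\in\Omega:u(x,t)\le a\}$ is relatively closed in $\mathbb R^n\times[0,T)$ (the latter is automatic if $u$, extended by $+\infty$ outside $\Omega$, is continuous on $\mathbb R^n\times[0,T)$); 2. on $\{(x,t)\in\Omega:u(x,t)<a+1\}$ the function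 $u$ is smooth (up to and including $t=0$), $H>0$, and $u$ solves the graphical $H^\alpha$-flow $$\frac{\partial_tu}{\sqrt{1+|\nabla u|^2}}=H^\alpha ;$$ 3. $w\ge2\underline w$ on $\{(x,t)\in\Omega:\psi(x,t)>0\}$. Then $\sup_{x\in\Omega_0}\psi(x,0)\,H(x,0)<\infty$ and, for all $(x,t)\in\Omega$, $$\psi(x,t)\,H(x,t)\le C\,\max\left\{\sup_{x\in\Omega_0}\psi(x,0)\,H(x,0),\;1\right\},$$ where $\psi H$ is understood as $0$ where $\psi=0$, and the supremum is read as $0$ if $\Omega_0=\emptyset$. -/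

import Mathlib

open scoped ContDiff

noncomputable section

/-- The time interval `[0, T)`, where `T = ⊤` is allowed. -/
def timeInterval (T : EReal) : Set ℝ := {t : ℝ | 0 ≤ t ∧ (t : EReal) < T}

/-- The divergence `∑ i, ∂ᵢ Fⁱ` of a vector field on `ℝⁿ`. -/
def divergence {n : ℕ} (F : EuclideanSpace ℝ (Fin n) → EuclideanSpace ℝ (Fin n))
    (x : EuclideanSpace ℝ (Fin n)) : ℝ :=
  ∑ i : Fin n, (fderiv ℝ F x (EuclideanSpace.single i 1)) i

/-- The area element `√(1 + |∇f|²)` of the graph of `f`. -/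
def areaElement {n : ℕ} (f : EuclideanSpace ℝ (Fin n) → ℝ)
    (x : EuclideanSpace ℝ (Fin n)) : ℝ :=
  Real.sqrt (1 + ‖gradient f x‖ ^ 2)

/-- The quantity `w = ⟨ν, eₙ₊₁⟩ = 1 / √(1 + |∇f|²)` of the graph of `f`, where `ν` is the
unit normal `(-∇f, 1) / √(1 + |∇f|²)`. -/
def normalHeight {n : ℕ} (f : EuclideanSpace ℝ (Fin n) → ℝ)
    (x : EuclideanSpace ℝ (Fin n)) : ℝ :=
  1 / areaElement f x

/-- The mean curvature `H = div (∇f / √(1 + |∇f|²))` of the graph of `f`, with respect to the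
upward unit normal. -/
def meanCurvature {n : ℕ} (f : EuclideanSpace ℝ (Fin n) → ℝ)
    (x : EuclideanSpace ℝ (Fin n)) : ℝ :=
  divergence (fun y => (1 / areaElement f y) • gradient f y) x

/-- The localization function `ψ = (a - Xⁿ⁺¹)₊`, at the point `(x, u(x, t))` of the graph. -/
def cutoff {n : ℕ} (a : ℝ) (u : EuclideanSpace ℝ (Fin n) → ℝ → ℝ)
    (x : EuclideanSpace ℝ (Fin n)) (t : ℝ) : ℝ :=
  max (a - u x t) 0

/-- The part of the space-time domain over which the graphs lie below height `c`. -/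
def below {n : ℕ} (Ω : Set (EuclideanSpace ℝ (Fin n) × ℝ))
    (u : EuclideanSpace ℝ (Fin n) → ℝ → ℝ) (c : ℝ) :
    Set (EuclideanSpace ℝ (Fin n) × ℝ) :=
  {p | p ∈ Ω ∧ u p.1 p.2 < c}

/-- The graphs `M t` of `u (·, t)` over the slices of the space-time domain `Ω`, for `t` in
`[0, T)`, lie in the upper half-space, their parts of height at most `a` are compact, and their
parts below height `a + 1` are strictly mean convex and move by the `H ^ α`-flow.  Values of `u`
outside `Ω` play no role. -/
structure IsLocalGraphicalFlow {n : ℕ} (α a : ℝ) (T : EReal)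
    (Ω : Set (EuclideanSpace ℝ (Fin n) × ℝ)) (u : EuclideanSpace ℝ (Fin n) → ℝ → ℝ) :
    Prop where
  /-- `Ω` is relatively open in `ℝⁿ × [0, T)`. -/
  relOpen : ∃ O : Set (EuclideanSpace ℝ (Fin n) × ℝ), IsOpen O ∧
    Ω = O ∩ (Set.univ ×ˢ timeInterval T)
  continuousOn : ContinuousOn (fun p : EuclideanSpace ℝ (Fin n) × ℝ => u p.1 p.2) Ω
  nonneg : ∀ p ∈ Ω, 0 ≤ u p.1 p.2
  compact_slice : ∀ t ∈ timeInterval T, IsCompact {x | (x, t) ∈ Ω ∧ u x t ≤ a}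
  /-- The set `{u ≤ a}` is relatively closed in `ℝⁿ × [0, T)`: no part of `M t` of height at
  most `a` appears or disappears suddenly.  This is automatic if `u`, extended by `∞` outside
  `Ω`, is continuous on `ℝⁿ × [0, T)`. -/
  relClosed : ∃ K : Set (EuclideanSpace ℝ (Fin n) × ℝ), IsClosed K ∧
    {p | p ∈ Ω ∧ u p.1 p.2 ≤ a} = K ∩ (Set.univ ×ˢ timeInterval T)
  /-- `u` is smooth where `u < a + 1`, up to and including the initial time. -/
  smooth : ContDiffOn ℝ ∞ (fun p : EuclideanSpace ℝ (Fin n) × ℝ => u p.1 p.2)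
    (below Ω u (a + 1))
  meanConvex : ∀ p ∈ below Ω u (a + 1), 0 < meanCurvature (fun y => u y p.2) p.1
  flow : ∀ p ∈ below Ω u (a + 1),
    derivWithin (fun s => u p.1 s) (timeInterval T) p.2 / areaElement (fun y => u y p.2) p.1
      = meanCurvature (fun y => u y p.2) p.1 ^ α

end

/-! Write `v = 1/w` for the area element, `φ = ∂ₜu = v H^α`, `β = 1/α` and `c = wlow`. The maximum
principle is applied to `F = ψ^α φ / (1 - c v) = (ψ H)^α · v / (1 - c v)`. Where `ψ > 0` the
gradient bound gives `2 c v ≤ 1`, so the last factor lies in `[1, 1/c]` and `F` is comparable with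
`(ψ H)^α` (`testFunction_bounds`).

Since `H > 0`, `u` increases in time. Hence the space-time points of height at most `a` up to a
given time lie over the initial sublevel set and form a compact set (`isCompact_sublevel`), on which
`F` attains its maximum. `F` vanishes where `u = a`, so a positive maximum lies in `u < a`. At time
zero it is controlled by the initial supremum.

At a positive time, `log F` satisfies the first and second order conditions in space and has
nonnegative time derivative. The flow equation, in the form `v² tr D²u - D²u(∇u, ∇u) = v^(3-β) φ^β`,
is differentiated in time and in the direction of `∇u` (`linearized_flow`). This replaces the third
derivatives of `u` in the trace of `D² log F` with respect to the inverse metric. The first order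
condition eliminates `∇φ`, and the terms quadratic in `D²u ∇u` cancel (`reaction_le_of_traces`).

What survives is a good term `k |h|²` coming from `-log (1 - c v)`, where `h` is `v` times the
second fundamental form in an orthonormal frame. It is bounded by terms of order `|h|/ψ` and `1/ψ²`
(`estimate_of_reaction_le`). Together with `v H = tr h ≤ √n |h|` this bounds `ψ H` by a constant
(`curvatureBound_pos_of_estimate`). -/

open Matrix Filter Topology

/-! ### Linear algebra of the inverse metric of a graph. -/

/-- The trace of a bilinear form with respect to the inverse metric `δ - p ⊗ p / v²` of a graph
with gradient `p` and area element `v`. -/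
noncomputable def graphTrace {n : ℕ} (p : Fin n → ℝ) (v : ℝ) (B : Matrix (Fin n) (Fin n) ℝ) : ℝ :=
  B.trace - (p ⬝ᵥ B *ᵥ p) / v ^ 2

section GraphTrace

variable {n : ℕ} (p : Fin n → ℝ) (v : ℝ)

lemma graphTrace_add (A B : Matrix (Fin n) (Fin n) ℝ) :
    graphTrace p v (A + B) = graphTrace p v A + graphTrace p v B := by
  simp only [graphTrace, trace_add, add_mulVec, dotProduct_add]; ring

lemma graphTrace_smul (k : ℝ) (B : Matrix (Fin n) (Fin n) ℝ) :
    graphTrace p v (k • B) = k * graphTrace p v B := by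
  simp only [graphTrace, trace_smul, smul_mulVec, dotProduct_smul, smul_eq_mul]; ring

lemma dotProduct_vecMulVec_mulVec (x y : Fin n → ℝ) :
    x ⬝ᵥ (vecMulVec y y) *ᵥ x = (x ⬝ᵥ y) ^ 2 := by
  rw [vecMulVec_mulVec]
  simp [dotProduct_smul, dotProduct_comm y x, sq]

lemma graphTrace_vecMulVec (x : Fin n → ℝ) :
    graphTrace p v (vecMulVec x x) = x ⬝ᵥ x - (p ⬝ᵥ x) ^ 2 / v ^ 2 := by
  rw [graphTrace, dotProduct_vecMulVec_mulVec, trace_vecMulVec]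

variable {p v}

/-- The symmetric square root of the inverse metric of a graph. -/
lemma exists_sqrt_inverseMetric (hv : 0 < v) (hvp : v ^ 2 = 1 + p ⬝ᵥ p) :
    ∃ S : Matrix (Fin n) (Fin n) ℝ, Sᵀ = S ∧ S * S = 1 - (v ^ 2)⁻¹ • vecMulVec p p ∧
      p = v • (S *ᵥ p) := by
  have hv1 : v + 1 ≠ 0 := by positivity
  have hpp : p ⬝ᵥ p = v ^ 2 - 1 := by linarith
  have hmul : vecMulVec p p * vecMulVec p p = (p ⬝ᵥ p) • vecMulVec p p := by
    rw [vecMulVec_mul_vecMulVec, vecMulVec_smul]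
  -- The inverse metric has eigenvalue `1/v²` on `p` and `1` on its complement. The coefficient is
  -- chosen so that the eigenvalue on `p` becomes `1 - (v² - 1)/(v (v + 1)) = 1/v`.
  refine ⟨1 - (v * (v + 1))⁻¹ • vecMulVec p p, ?_, ?_, ?_⟩
  · simp [transpose_vecMulVec]
  · rw [sub_mul, mul_sub, mul_sub, one_mul, mul_one, one_mul, smul_mul_smul_comm, hmul, smul_smul,
      hpp, sub_sub, ← add_sub_assoc, ← add_smul, ← sub_smul]
    congr 2
    field_simp
    ring
  · rw [sub_mulVec, one_mulVec, smul_mulVec, vecMulVec_mulVec, hpp]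
    ext i
    simp only [Pi.smul_apply, Pi.sub_apply, smul_eq_mul, MulOpposite.smul_eq_mul_unop,
      MulOpposite.unop_op]
    field_simp
    ring

lemma graphTrace_eq_trace {S : Matrix (Fin n) (Fin n) ℝ}
    (hS : S * S = 1 - (v ^ 2)⁻¹ • vecMulVec p p) (B : Matrix (Fin n) (Fin n) ℝ) :
    graphTrace p v B = (S * B * S).trace := by
  rw [trace_mul_comm, ← mul_assoc, hS, sub_mul, one_mul, trace_sub, smul_mul, trace_smul,
    vecMulVec_mul, trace_vecMulVec, dotProduct_comm p, ← dotProduct_mulVec, graphTrace,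
    smul_eq_mul, div_eq_inv_mul]

/-- The trace of `S B S` is the sum of the values of the form `B` on the rows of `S`. -/
lemma graphTrace_nonpos (hv : 0 < v) (hvp : v ^ 2 = 1 + p ⬝ᵥ p) {B : Matrix (Fin n) (Fin n) ℝ}
    (hB : ∀ ξ, ξ ⬝ᵥ B *ᵥ ξ ≤ 0) : graphTrace p v B ≤ 0 := by
  obtain ⟨S, hT, hS, -⟩ := exists_sqrt_inverseMetric hv hvp
  rw [graphTrace_eq_trace hS]
  refine Finset.sum_nonpos fun m _ => ?_
  refine le_of_eq_of_le ?_ (hB (S m))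
  have hcol : (fun j => S j m) = S m := by
    conv_rhs => rw [← hT]
    rfl
  rw [diag_apply, mul_apply', hcol, dotProduct_mulVec]
  rfl

/-- With `h = S r S`, the second fundamental form in an orthonormal frame, up to the factor `v`. -/
lemma exists_frame_matrix (hv : 0 < v) (hvp : v ^ 2 = 1 + p ⬝ᵥ p) {r : Matrix (Fin n) (Fin n) ℝ}
    (hr : rᵀ = r) :
    ∃ h : Matrix (Fin n) (Fin n) ℝ, graphTrace p v r = h.trace ∧
      p ⬝ᵥ r *ᵥ p = v ^ 2 * (p ⬝ᵥ h *ᵥ p) ∧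
      graphTrace p v (r * r) - graphTrace p v (vecMulVec (r *ᵥ p) (r *ᵥ p)) / v ^ 2
        = ∑ i, ∑ j, h i j ^ 2 := by
  obtain ⟨S, hT, hS, hp⟩ := exists_sqrt_inverseMetric hv hvp
  refine ⟨S * r * S, graphTrace_eq_trace hS r, ?_, ?_⟩
  · have hvm : p ᵥ* S = S *ᵥ p := by rw [← vecMul_transpose, hT]
    have : p ⬝ᵥ (S * r * S) *ᵥ p = (S *ᵥ p) ⬝ᵥ r *ᵥ (S *ᵥ p) := by
      rw [← mulVec_mulVec, ← mulVec_mulVec, dotProduct_mulVec, hvm]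
    rw [this]
    conv_lhs => rw [hp]
    rw [mulVec_smul, smul_dotProduct, dotProduct_smul, smul_eq_mul, smul_eq_mul]
    ring
  · have hvm : (r *ᵥ p) = p ᵥ* r := by rw [← vecMul_transpose, hr]
    -- Inserting `S² = 1 - p ⊗ p / v²` between the two factors `r` produces the rank one correction.
    have h1 : r * r + (-(v ^ 2)⁻¹) • vecMulVec (r *ᵥ p) (r *ᵥ p) = r * (S * S) * r := by
      rw [hS, mul_sub, sub_mul, mul_one, Matrix.mul_smul, smul_mul, mul_vecMulVec, vecMulVec_mul,
        neg_smul, sub_eq_add_neg]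
      conv_lhs => enter [2, 1, 2, 2]; rw [hvm]
    have h2 : graphTrace p v (r * r) - graphTrace p v (vecMulVec (r *ᵥ p) (r *ᵥ p)) / v ^ 2
        = graphTrace p v (r * (S * S) * r) := by
      rw [← h1, graphTrace_add, graphTrace_smul]; ring
    have h3 : S * (r * (S * S) * r) * S = (S * r * S) * (S * r * S) := by
      simp only [mul_assoc]
    have h4 : (S * r * S)ᵀ = S * r * S := by
      rw [transpose_mul, transpose_mul, hT, hr, mul_assoc]
    rw [h2, graphTrace_eq_trace hS, h3]
    conv_lhs => enter [1, 2]; rw [← h4]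
    simp only [trace, diag_apply, mul_apply', transpose_apply, sq]
    rfl

/-- Cauchy–Schwarz over pairs of indices, between `p ⊗ p` and `h`. -/
lemma abs_dotProduct_mulVec_le (h : Matrix (Fin n) (Fin n) ℝ) (p : Fin n → ℝ) {R : ℝ} (hR : 0 ≤ R)
    (hR2 : R ^ 2 = ∑ i, ∑ j, h i j ^ 2) : |p ⬝ᵥ h *ᵥ p| ≤ (p ⬝ᵥ p) * R := by
  have hpp : 0 ≤ p ⬝ᵥ p := Finset.sum_nonneg fun i _ => mul_self_nonneg _
  refine abs_le_of_sq_le_sq ?_ (by positivity)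
  have e1 : p ⬝ᵥ h *ᵥ p = ∑ x ∈ (Finset.univ ×ˢ Finset.univ : Finset (Fin n × Fin n)),
      (p x.1 * p x.2) * h x.1 x.2 := by
    rw [Finset.sum_product]
    simp only [dotProduct, mulVec, Finset.mul_sum]
    exact Finset.sum_congr rfl fun i _ => Finset.sum_congr rfl fun j _ => by ring
  have e2 : (p ⬝ᵥ p) ^ 2 = ∑ x ∈ (Finset.univ ×ˢ Finset.univ : Finset (Fin n × Fin n)),
      (p x.1 * p x.2) ^ 2 := by
    rw [Finset.sum_product, sq, dotProduct, Finset.sum_mul_sum]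
    exact Finset.sum_congr rfl fun i _ => Finset.sum_congr rfl fun j _ => by ring
  have e3 : R ^ 2 = ∑ x ∈ (Finset.univ ×ˢ Finset.univ : Finset (Fin n × Fin n)),
      h x.1 x.2 ^ 2 := by rw [Finset.sum_product, hR2]
  rw [mul_pow, e1, e2, e3]
  exact Finset.sum_mul_sq_le_sq_mul_sq _ _ _

lemma trace_sq_le (h : Matrix (Fin n) (Fin n) ℝ) :
    h.trace ^ 2 ≤ n * ∑ i, ∑ j, h i j ^ 2 := by
  have := sq_sum_le_card_mul_sum_sq (s := (Finset.univ : Finset (Fin n))) (f := fun i => h i i)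
  simp only [Finset.card_univ, Fintype.card_fin] at this
  refine this.trans ?_
  gcongr with i
  exact Finset.single_le_sum (f := fun j => h i j ^ 2) (fun j _ => sq_nonneg _) (Finset.mem_univ i)

end GraphTrace

/-! ### The algebraic estimate at an interior maximum. -/

/-- A bound for `ψ H` at an interior maximum of the test function. -/
noncomputable def curvatureBound (n : ℕ) (α c : ℝ) : ℝ :=
  √n * (1 + (((1 + α) * √n + 4 * α) + (α + α ^ 2)) / c)

/-- In the scale-invariant variable `y = ψ R / v` the hypothesis becomes `c y² ≤ b y + d`, thanks to
`v ≥ 1`. If `y > 1`, the right side is at most `(b + d) y`, which forces `y ≤ (b + d)/c`. Finally `ψ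
H ≤ √n y`. -/
lemma curvatureBound_pos_of_estimate {n : ℕ} {α c v ψ R H : ℝ} (hα : 0 < α) (hc : 0 < c)
    (hv : 1 ≤ v) (hψ : 0 < ψ) (hR : 0 ≤ R) (hH : v * H ≤ √n * R)
    (h : c * R ^ 2 / v ≤ ((1 + α) * √n + 4 * α) * R / ψ + (α + α ^ 2) / ψ ^ 2) :
    ψ * H ≤ curvatureBound n α c := by
  set b := (1 + α) * √n + 4 * α with hb
  set d := α + α ^ 2 with hd
  have hb0 : 0 ≤ b := by positivity
  have hd0 : 0 ≤ d := by positivity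
  have hv0 : 0 < v := by linarith
  set y := ψ * R / v with hy
  have hy0 : 0 ≤ y := by positivity
  have h1 : c * v * y ^ 2 ≤ b * v * y + d := by
    have := mul_le_mul_of_nonneg_left h (sq_nonneg ψ)
    have e1 : ψ ^ 2 * (c * R ^ 2 / v) = c * v * y ^ 2 := by rw [hy]; field_simp
    have e2 : ψ ^ 2 * (b * R / ψ + d / ψ ^ 2) = b * v * y + d := by rw [hy]; field_simp
    linarith
  have h2 : c * y ^ 2 ≤ b * y + d := by
    have : v * (c * y ^ 2) ≤ v * (b * y + d) := by nlinarith
    exact le_of_mul_le_mul_left this hv0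
  have h3 : y ≤ 1 + (b + d) / c := by
    by_contra! hlt
    have hbd : 0 ≤ (b + d) / c := by positivity
    have hy1 : 1 < y := by linarith
    have h4 : b + d < c * y := by
      have : (b + d) / c < y := by linarith
      rwa [div_lt_iff₀ hc, mul_comm] at this
    nlinarith
  have h5 : ψ * H ≤ √n * y := by
    have : ψ * H = ψ * (v * H) / v := by field_simp
    have e : √n * y = ψ * (√n * R) / v := by rw [hy]; ring
    rw [this, e]
    gcongr
  exact h5.trans (mul_le_mul_of_nonneg_left h3 (Real.sqrt_nonneg _))

/-- The gradient terms at a maximum of the test function cancel.  Here `τ = |p|²`,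
`ρ = r(p, p)`, `σ = |r p|²` and `k = c / (m v)`. -/
lemma reaction_le_of_traces {α β v s φ φt H γ τ ρ σ k R2 TΦ TE pq qrp qq t : ℝ}
    (hαβ : α * β = 1) (hv : 0 < v) (hφ : 0 < φ) (hβ : 0 < β) (hγ : 0 < γ) (hγφ : γ * φ = v * H)
    (hτ : τ = v ^ 2 - 1) (ht : t = v * H + ρ / v ^ 2)
    (hpq : pq = φ * (α * s * τ - k * ρ)) (hqrp : qrp = φ * (α * s * ρ - k * σ))
    (hqq : qq = φ ^ 2 * ((α * s) ^ 2 * τ - 2 * (α * s) * k * ρ + k ^ 2 * σ))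
    (hTΦ : TΦ = 2 * qrp / v ^ 2 - 2 * pq * t / v ^ 2 + (3 - β) * pq * H / v + β * γ * φt)
    (hTE : TE = 2 * σ / v ^ 2 - 2 * ρ * t / v ^ 2 + (3 - β) * ρ * H / v + β * γ * pq)
    (htime : 0 ≤ -(α * s * φ) + φt / φ + k * pq)
    (hT : -(α * s) * (v * H) + -(α * s ^ 2) * (τ - τ ^ 2 / v ^ 2) + φ⁻¹ * TΦ
      + -(φ ^ 2)⁻¹ * (qq - pq ^ 2 / v ^ 2) + k * (R2 + (σ - ρ ^ 2 / v ^ 2) / v ^ 2) + k * TE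
      + (k ^ 2 - k / v ^ 2) * (σ - ρ ^ 2 / v ^ 2) ≤ 0) :
    k * R2 ≤ (α - 1) * H * s / v + (α + α ^ 2) * (τ / v ^ 2) * s ^ 2
      - 2 * α * s * k * ρ / v ^ 2 - 2 * α * s * ρ / v ^ 4 := by
  -- The factor `β γ` gives `φt` and `pq` the coefficients they have in `TΦ / φ` and `k TE`, so that
  -- both drop out on subtraction.
  have htime' : 0 ≤ β * γ * φt / φ + β * γ * k * pq - v * H * s := by
    have := mul_nonneg (mul_pos hβ hγ).le htime
    have e : β * γ * (-(α * s * φ) + φt / φ + k * pq)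
        = β * γ * φt / φ + β * γ * k * pq - (α * β) * (γ * φ) * s := by ring
    rw [e, hαβ, hγφ] at this
    linarith
  have hαβs : α * β * s = s := by rw [hαβ, one_mul]
  -- The claim is the trace inequality minus the time inequality. Once `TΦ`, `TE`, `q` and `t` are
  -- substituted, all terms in `σ` and `ρ²` cancel identically.
  suffices hs : k * R2 - ((α - 1) * H * s / v + (α + α ^ 2) * (τ / v ^ 2) * s ^ 2
      - 2 * α * s * k * ρ / v ^ 2 - 2 * α * s * ρ / v ^ 4)
      = (-(α * s) * (v * H) + -(α * s ^ 2) * (τ - τ ^ 2 / v ^ 2) + φ⁻¹ * TΦ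
      + -(φ ^ 2)⁻¹ * (qq - pq ^ 2 / v ^ 2) + k * (R2 + (σ - ρ ^ 2 / v ^ 2) / v ^ 2) + k * TE
      + (k ^ 2 - k / v ^ 2) * (σ - ρ ^ 2 / v ^ 2))
      - (β * γ * φt / φ + β * γ * k * pq - v * H * s) by linarith
  have hTΦ' : φ⁻¹ * TΦ = 2 * (α * s * ρ - k * σ) / v ^ 2
      - 2 * (α * s * τ - k * ρ) * t / v ^ 2
      + (3 - β) * (α * s * τ - k * ρ) * H / v + β * γ * φt / φ := by
    rw [hTΦ, hqrp, hpq]; field_simp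
  have hqq' : (φ ^ 2)⁻¹ * (qq - pq ^ 2 / v ^ 2)
      = ((α * s) ^ 2 * τ - 2 * (α * s) * k * ρ + k ^ 2 * σ)
        - (α * s * τ - k * ρ) ^ 2 / v ^ 2 := by
    rw [hqq, hpq]; field_simp
  rw [hTΦ', neg_mul (φ ^ 2)⁻¹, hqq', hTE, ht, hτ]
  have h3 : (3 - β) * (α * s * (v ^ 2 - 1) - k * ρ) * H / v
      = (3 * α - 1) * s * (v ^ 2 - 1) * H / v - (3 - β) * k * ρ * H / v := by
    linear_combination (-((v ^ 2 - 1) * H / v)) * hαβs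
  rw [h3]
  field_simp
  ring

/-- The lower order terms in the estimate at a maximum of the test function. -/
lemma estimate_of_reaction_le {n : ℕ} {α c v ψ R H τ ρ m k : ℝ} (hα : 0 < α) (hc : 0 < c)
    (hv : 1 ≤ v) (hψ : 0 < ψ) (hR : 0 ≤ R) (hH0 : 0 < H) (hH : v * H ≤ √n * R)
    (hm : m = 1 - c * v) (hcv : 2 * (c * v) ≤ 1) (hk : k = c / (m * v)) (hτ : τ = v ^ 2 - 1)
    (hρ : |ρ| ≤ v ^ 2 * (τ * R))
    (h : k * R ^ 2 ≤ (α - 1) * H * ψ⁻¹ / v + (α + α ^ 2) * (τ / v ^ 2) * ψ⁻¹ ^ 2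
      - 2 * α * ψ⁻¹ * k * ρ / v ^ 2 - 2 * α * ψ⁻¹ * ρ / v ^ 4) :
    c * R ^ 2 / v ≤ ((1 + α) * √n + 4 * α) * R / ψ + (α + α ^ 2) / ψ ^ 2 := by
  have hv0 : 0 < v := by linarith
  have hm0 : 0 < m := by linarith
  have hρ' : |ρ| ≤ v ^ 4 * R := by
    have : τ * R ≤ v ^ 2 * R := by gcongr; linarith
    nlinarith [sq_nonneg v]
  have t0 : c * R ^ 2 / v ≤ k * R ^ 2 := by
    have : k * R ^ 2 = c * R ^ 2 / (m * v) := by rw [hk]; ring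
    rw [this]
    gcongr
    nlinarith [mul_pos hc hv0]
  have t1 : (α - 1) * H * ψ⁻¹ / v ≤ (1 + α) * √n * R / ψ := by
    have hHle : H / v ≤ √n * R := by
      rw [div_le_iff₀ hv0]; nlinarith [mul_nonneg (Real.sqrt_nonneg (n:ℝ)) hR]
    have e : (α - 1) * H * ψ⁻¹ / v = (α - 1) * (H / v) / ψ := by field_simp
    have hHv : 0 < H / v := by positivity
    rw [e, mul_assoc]
    refine div_le_div_of_nonneg_right ?_ hψ.le
    calc (α - 1) * (H / v) ≤ (1 + α) * (H / v) := by gcongr; linarith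
      _ ≤ (1 + α) * (√n * R) := by gcongr
  have t2 : (α + α ^ 2) * (τ / v ^ 2) * ψ⁻¹ ^ 2 ≤ (α + α ^ 2) / ψ ^ 2 := by
    have e : (α + α ^ 2) * (τ / v ^ 2) * ψ⁻¹ ^ 2 = (α + α ^ 2) * (τ / v ^ 2) / ψ ^ 2 := by
      field_simp
    rw [e]
    gcongr
    have : τ / v ^ 2 ≤ 1 := by rw [div_le_one (by positivity)]; linarith
    nlinarith [sq_nonneg α]
  have hnρ : -ρ ≤ v ^ 4 * R := (neg_le_abs ρ).trans hρ'
  have e2 : 2 * α * R / ψ = 2 * α / ψ * R := by ring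
  have t3 : -(2 * α * ψ⁻¹ * k * ρ / v ^ 2) ≤ 2 * α * R / ψ := by
    have e : -(2 * α * ψ⁻¹ * k * ρ / v ^ 2) = 2 * α / ψ * (c / (m * v ^ 3) * (-ρ)) := by
      rw [hk]; field_simp
    rw [e, e2]
    gcongr
    -- The assumption `2 c v ≤ 1` enters as `c v ≤ 1 - c v = m`.
    calc c / (m * v ^ 3) * (-ρ) ≤ c / (m * v ^ 3) * (v ^ 4 * R) := by gcongr
      _ = (c * v / m) * R := by field_simp
      _ ≤ 1 * R := by
        gcongr
        rw [div_le_one hm0]; linarith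
      _ = R := one_mul _
  have t4 : -(2 * α * ψ⁻¹ * ρ / v ^ 4) ≤ 2 * α * R / ψ := by
    have e : -(2 * α * ψ⁻¹ * ρ / v ^ 4) = 2 * α / ψ * (-ρ / v ^ 4) := by
      field_simp
    rw [e, e2]
    gcongr
    rw [div_le_iff₀ (by positivity)]; linarith
  have : ((1 + α) * √n + 4 * α) * R / ψ
      = (1 + α) * √n * R / ψ + 2 * α * R / ψ + 2 * α * R / ψ := by ring
  linarith

/-- The estimate at a maximum of the test function `α log (a - u) + log φ - log (1 - c v)`,
in terms of the derivatives there: `p` and `r` are the gradient and the Hessian of `u`,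
`q` and `Φ` those of `φ = ∂ₜu`, and `E` is the Hessian of the derivative of `u` in the
direction `p`. -/
lemma mul_curvature_le_of_isMax {n : ℕ} {α β c v ψ φ φt H γ : ℝ} {p q : Fin n → ℝ}
    {r Φ E : Matrix (Fin n) (Fin n) ℝ} (hα : 0 < α) (hαβ : α * β = 1) (hc : 0 < c) (hv : 0 < v)
    (hvp : v ^ 2 = 1 + p ⬝ᵥ p) (hcv : 2 * (c * v) ≤ 1) (hψ : 0 < ψ) (hφ : 0 < φ) (hH : 0 < H)
    (hγ : 0 < γ) (hγφ : γ * φ = v * H) (hr : rᵀ = r)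
    (heq : v ^ 2 * r.trace - p ⬝ᵥ r *ᵥ p = v ^ 3 * H)
    (hΦ : 2 * (p ⬝ᵥ q) * r.trace + v ^ 2 * Φ.trace - p ⬝ᵥ Φ *ᵥ p - 2 * (q ⬝ᵥ r *ᵥ p)
      = (3 - β) * (p ⬝ᵥ q) * (v * H) + β * v ^ 2 * γ * φt)
    (hE : 2 * (p ⬝ᵥ r *ᵥ p) * r.trace + v ^ 2 * E.trace - p ⬝ᵥ E *ᵥ p
        - 2 * (r *ᵥ p ⬝ᵥ r *ᵥ p)
      = (3 - β) * (p ⬝ᵥ r *ᵥ p) * (v * H) + β * v ^ 2 * γ * (p ⬝ᵥ q))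
    (h1 : ∀ i, -(α * p i / ψ) + q i / φ + c * ((r *ᵥ p) i / v) / (1 - c * v) = 0)
    (ht : 0 ≤ -(α * φ / ψ) + φt / φ + c * (p ⬝ᵥ q / v) / (1 - c * v))
    (h2 : ∀ ξ : Fin n → ℝ, -(α * (ξ ⬝ᵥ r *ᵥ ξ) / ψ) - α * (ξ ⬝ᵥ p) ^ 2 / ψ ^ 2
      + (ξ ⬝ᵥ Φ *ᵥ ξ) / φ - (ξ ⬝ᵥ q) ^ 2 / φ ^ 2
      + c * ((ξ ⬝ᵥ (r * r) *ᵥ ξ + ξ ⬝ᵥ E *ᵥ ξ) / v - (ξ ⬝ᵥ r *ᵥ p) ^ 2 / v ^ 3) / (1 - c * v)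
      + c ^ 2 * ((ξ ⬝ᵥ r *ᵥ p) / v) ^ 2 / (1 - c * v) ^ 2 ≤ 0) :
    ψ * H ≤ curvatureBound n α c := by
  have hv1 : 1 ≤ v := by
    have hpp : 0 ≤ p ⬝ᵥ p := Finset.sum_nonneg fun i _ => mul_self_nonneg _
    nlinarith
  have hm : 0 < 1 - c * v := by linarith
  obtain ⟨m, hmdef⟩ : ∃ m, m = 1 - c * v := ⟨_, rfl⟩
  rw [← hmdef] at hm ht
  simp only [← hmdef] at h1 h2
  obtain ⟨h, hh1, hh2, hh3⟩ := exists_frame_matrix hv hvp hr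
  obtain ⟨R2, hR2⟩ : ∃ R2, R2 = ∑ i, ∑ j, h i j ^ 2 := ⟨_, rfl⟩
  rw [← hR2] at hh3
  have hR20 : 0 ≤ R2 := hR2 ▸ Finset.sum_nonneg fun i _ => Finset.sum_nonneg fun j _ => sq_nonneg _
  have hRsq : √R2 ^ 2 = R2 := Real.sq_sqrt hR20
  have hR0 : 0 ≤ √R2 := Real.sqrt_nonneg _
  have hab := abs_dotProduct_mulVec_le h p hR0 (hRsq.trans hR2)
  have htr := trace_sq_le h
  rw [← hR2] at htr
  -- the trace of the second derivative test
  obtain ⟨k, hk⟩ : ∃ k, k = c / (m * v) := ⟨_, rfl⟩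
  have hT : graphTrace p v ((-(α * ψ⁻¹)) • r + (-(α * ψ⁻¹ ^ 2)) • vecMulVec p p + φ⁻¹ • Φ
      + (-(φ ^ 2)⁻¹) • vecMulVec q q + k • (r * r) + k • E
      + (k ^ 2 - k / v ^ 2) • vecMulVec (r *ᵥ p) (r *ᵥ p)) ≤ 0 := by
    -- The coefficient `k² - k/v²` of `(r p) ⊗ (r p)` collects the square of the derivative of `log
    -- (1 - c v)` and the last term in the Hessian of `v`.
    refine graphTrace_nonpos hv hvp fun ξ => ?_
    refine le_of_eq_of_le ?_ (h2 ξ)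
    simp only [add_mulVec, smul_mulVec, dotProduct_add, dotProduct_smul, smul_eq_mul,
      dotProduct_vecMulVec_mulVec]
    rw [hk]
    generalize ξ ⬝ᵥ r *ᵥ ξ = x1, ξ ⬝ᵥ p = x2, ξ ⬝ᵥ Φ *ᵥ ξ = x3, ξ ⬝ᵥ q = x4,
      ξ ⬝ᵥ (r * r) *ᵥ ξ = x5, ξ ⬝ᵥ E *ᵥ ξ = x6, ξ ⬝ᵥ r *ᵥ p = x7
    field_simp
    ring
  simp only [graphTrace_add, graphTrace_smul, graphTrace_vecMulVec] at hT
  rw [graphTrace_vecMulVec] at hh3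
  -- The first order condition, solved for the gradient of `φ`.
  have hq : q = φ • ((α * ψ⁻¹) • p - (k) • (r *ᵥ p)) := by
    ext i
    have := h1 i
    simp only [Pi.smul_apply, Pi.sub_apply, smul_eq_mul, hk]
    field_simp at this ⊢
    linarith
  have hpq : p ⬝ᵥ q = φ * (α * ψ⁻¹ * (p ⬝ᵥ p) - k * (p ⬝ᵥ r *ᵥ p)) := by
    rw [hq]; simp only [dotProduct_smul, dotProduct_sub, smul_eq_mul]
  have hqrp : q ⬝ᵥ r *ᵥ p
      = φ * (α * ψ⁻¹ * (p ⬝ᵥ r *ᵥ p) - k * (r *ᵥ p ⬝ᵥ r *ᵥ p)) := by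
    rw [hq]; simp only [smul_dotProduct, sub_dotProduct, smul_eq_mul]
  have hqq : q ⬝ᵥ q = φ ^ 2 * ((α * ψ⁻¹) ^ 2 * (p ⬝ᵥ p) - 2 * (α * ψ⁻¹) * (k) *
      (p ⬝ᵥ r *ᵥ p) + (k) ^ 2 * (r *ᵥ p ⬝ᵥ r *ᵥ p)) := by
    rw [hq]; simp only [smul_dotProduct, sub_dotProduct, smul_eq_mul, dotProduct_smul,
      dotProduct_sub, dotProduct_comm (r *ᵥ p) p]; ring
  have hTr : graphTrace p v r = v * H := by
    rw [graphTrace]; field_simp; linarith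
  have hTΦ : graphTrace p v Φ = 2 * (q ⬝ᵥ r *ᵥ p) / v ^ 2 - 2 * (p ⬝ᵥ q) * r.trace / v ^ 2
      + (3 - β) * (p ⬝ᵥ q) * H / v + β * γ * φt := by
    rw [graphTrace]; field_simp; linarith
  have hTE : graphTrace p v E = 2 * (r *ᵥ p ⬝ᵥ r *ᵥ p) / v ^ 2
      - 2 * (p ⬝ᵥ r *ᵥ p) * r.trace / v ^ 2
      + (3 - β) * (p ⬝ᵥ r *ᵥ p) * H / v + β * γ * (p ⬝ᵥ q) := by
    rw [graphTrace]; field_simp; linarith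
  have hTrr : graphTrace p v (r * r) = R2 + ((r *ᵥ p ⬝ᵥ r *ᵥ p)
      - (p ⬝ᵥ r *ᵥ p) ^ 2 / v ^ 2) / v ^ 2 := by linarith
  have htrace : r.trace = v * H + (p ⬝ᵥ r *ᵥ p) / v ^ 2 := by
    field_simp; linarith
  have hppv : p ⬝ᵥ p = v ^ 2 - 1 := by linarith
  have hβ : 0 < β := (pos_iff_pos_of_mul_pos (hαβ ▸ one_pos)).mp hα
  have hkey := reaction_le_of_traces (s := ψ⁻¹) (R2 := R2) hαβ hv hφ hβ hγ hγφ
    hppv htrace hpq hqrp hqq hTΦ hTE (by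
      refine le_of_le_of_eq ht ?_
      rw [hk]
      field_simp) (by rwa [hTr, hTrr] at hT)
  have hHR : v * H ≤ √n * √R2 := by
    rw [← Real.sqrt_mul (Nat.cast_nonneg n), ← hTr, hh1]
    exact Real.le_sqrt_of_sq_le htr
  refine curvatureBound_pos_of_estimate hα hc hv1 hψ hR0 hHR
    (estimate_of_reaction_le hα hc hv1 hψ hR0 hH hHR hmdef hcv hk hppv ?_ (by rwa [hRsq]))
  rw [hh2, abs_mul, abs_of_nonneg (sq_nonneg v)]
  gcongr

/-! ### Directional derivatives and maximum tests along lines. -/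

/-- The derivative of `f` in the direction `τ`, as a function of the point. -/
noncomputable def dirDeriv {X : Type*} [NormedAddCommGroup X] [NormedSpace ℝ X] (τ : X) (f : X → ℝ)
    (z : X) : ℝ :=
  fderiv ℝ f z τ

section DirDeriv

variable {X : Type*} [NormedAddCommGroup X] [NormedSpace ℝ X] {f : X → ℝ}

lemma contDiff_dirDeriv (hf : ContDiff ℝ ∞ f) (τ : X) : ContDiff ℝ ∞ (dirDeriv τ f) :=
  (hf.fderiv_right (m := ∞) (by simp)).clm_apply contDiff_const

lemma dirDeriv_comm (hf : ContDiff ℝ ∞ f) (σ τ : X) :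
    dirDeriv σ (dirDeriv τ f) = dirDeriv τ (dirDeriv σ f) := by
  have hd : ∀ z, DifferentiableAt ℝ (fderiv ℝ f) z := fun z =>
    ((hf.fderiv_right (m := ∞) (by simp)).differentiable (by simp)) z
  have key : ∀ (σ τ : X) z, dirDeriv σ (dirDeriv τ f) z = fderiv ℝ (fderiv ℝ f) z σ τ := by
    intro σ τ z
    have : HasFDerivAt (dirDeriv τ f) ((fderiv ℝ (fderiv ℝ f) z).flip τ) z := by
      refine ((hd z).hasFDerivAt.clm_apply (hasFDerivAt_const τ z)).congr_fderiv ?_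
      ext; simp
    rw [dirDeriv, this.fderiv, ContinuousLinearMap.flip_apply]
  ext z
  rw [key, key]
  exact (hf.contDiffAt.isSymmSndFDerivAt
    (by rw [minSmoothness_of_isRCLikeNormedField]; exact WithTop.coe_le_coe.2 le_top)).eq σ τ

lemma dirDeriv_sum_smul {ι : Type*} (s : Finset ι) (c : ι → ℝ) (τ : ι → X) (f : X → ℝ) :
    dirDeriv (∑ i ∈ s, c i • τ i) f = fun z => ∑ i ∈ s, c i * dirDeriv (τ i) f z := by
  ext z
  simp [dirDeriv]

lemma dirDeriv_sum_const_mul {ι : Type*} (s : Finset ι) (c : ι → ℝ) {g : ι → X → ℝ}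
    (hg : ∀ i, ContDiff ℝ ∞ (g i)) (τ : X) :
    dirDeriv τ (fun z => ∑ i ∈ s, c i * g i z) = fun z => ∑ i ∈ s, c i * dirDeriv τ (g i) z := by
  ext z
  have : HasFDerivAt (fun z => ∑ i ∈ s, c i * g i z) (∑ i ∈ s, c i • fderiv ℝ (g i) z) z :=
    HasFDerivAt.fun_sum fun i _ =>
      (((hg i).differentiable (by simp)) z).hasFDerivAt.const_mul (c i)
  rw [dirDeriv, this.fderiv]
  simp [dirDeriv]

lemma hasDerivAt_comp_line (hf : ContDiff ℝ ∞ f) (z τ : X) (s : ℝ) :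
    HasDerivAt (fun s : ℝ => f (z + s • τ)) (dirDeriv τ f (z + s • τ)) s := by
  have h1 : HasDerivAt (fun s : ℝ => z + s • τ) τ s := by
    simpa using ((hasDerivAt_id s).smul_const τ).const_add z
  exact ((hf.differentiable (by simp)) _).hasFDerivAt.comp_hasDerivAt s h1

lemma hasDerivAt_comp_line_zero (hf : ContDiff ℝ ∞ f) (z τ : X) :
    HasDerivAt (fun s : ℝ => f (z + s • τ)) (dirDeriv τ f z) 0 := by
  simpa using hasDerivAt_comp_line hf z τ 0

lemma tendsto_line (z τ : X) : Tendsto (fun s : ℝ => z + s • τ) (𝓝 0) (𝓝 z) := by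
  have : Continuous fun s : ℝ => z + s • τ := by fun_prop
  simpa using this.tendsto 0

end DirDeriv

/-- The necessary conditions of first and second order for a local maximum. -/
lemma derivs_of_isLocalMax {ζ ζ1 : ℝ → ℝ} {k : ℝ} (hmax : IsLocalMax ζ 0)
    (h1 : ∀ᶠ s in 𝓝 0, HasDerivAt ζ (ζ1 s) s) (h2 : HasDerivAt ζ1 k 0) : ζ1 0 = 0 ∧ k ≤ 0 := by
  have e0 : ζ1 0 = 0 := hmax.hasDerivAt_eq_zero h1.self_of_nhds
  refine ⟨e0, ?_⟩
  -- If `k > 0`, the point would also be a local minimum, so `ζ` would be locally constant and its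
  -- second derivative zero.
  by_contra! hk
  have hder : deriv ζ =ᶠ[𝓝 0] ζ1 := h1.mono fun s hs => hs.deriv
  have hdd : deriv (deriv ζ) 0 = k := by rw [hder.deriv_eq, h2.deriv]
  have hmin : IsLocalMin ζ 0 := isLocalMin_of_deriv_deriv_pos (by rwa [hdd])
    (by rw [hder.self_of_nhds, e0]) h1.self_of_nhds.continuousAt
  have hconst : ζ =ᶠ[𝓝 0] fun _ => ζ 0 := by
    filter_upwards [hmax, hmin] with s hs1 hs2 using le_antisymm hs1 hs2
  have : deriv (deriv ζ) 0 = 0 := by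
    rw [hconst.deriv.deriv_eq]; simp
  linarith

section LogTest

variable {u u1 φ φ1 V V1 : ℝ → ℝ} {α a c : ℝ}

/-- Differentiates `log F` along a curve, with `φ` standing for `∂ₜu` and `V` for the area element.
-/
lemma hasDerivAt_logTest {s : ℝ} {du dφ dV : ℝ} (hu : HasDerivAt u du s)
    (hφ : HasDerivAt φ dφ s) (hV : HasDerivAt V dV s)
    (hu0 : 0 < a - u s) (hφ0 : 0 < φ s) (hV0 : 0 < 1 - c * V s) :
    HasDerivAt (fun s => α * Real.log (a - u s) + Real.log (φ s) - Real.log (1 - c * V s))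
      (-(α * du / (a - u s)) + dφ / φ s + c * dV / (1 - c * V s)) s := by
  refine (((((hu.const_sub a).log hu0.ne').const_mul α).fun_add (hφ.log hφ0.ne')).fun_sub
    (((hV.const_mul c).const_sub 1).log hV0.ne')).congr_deriv ?_
  ring

lemma derivs_of_isLocalMax_logTest {u2 φ2 V2 : ℝ}
    (hu : ∀ s, HasDerivAt u (u1 s) s) (hu' : HasDerivAt u1 u2 0)
    (hφ : ∀ s, HasDerivAt φ (φ1 s) s) (hφ' : HasDerivAt φ1 φ2 0)
    (hV : ∀ s, HasDerivAt V (V1 s) s) (hV' : HasDerivAt V1 V2 0)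
    (hu0 : 0 < a - u 0) (hφ0 : 0 < φ 0) (hV0 : 0 < 1 - c * V 0)
    (hmax : IsLocalMax
      (fun s => α * Real.log (a - u s) + Real.log (φ s) - Real.log (1 - c * V s)) 0) :
    -(α * u1 0 / (a - u 0)) + φ1 0 / φ 0 + c * V1 0 / (1 - c * V 0) = 0 ∧
    -(α * u2 / (a - u 0)) - α * u1 0 ^ 2 / (a - u 0) ^ 2 + φ2 / φ 0 - φ1 0 ^ 2 / φ 0 ^ 2
      + c * V2 / (1 - c * V 0) + c ^ 2 * V1 0 ^ 2 / (1 - c * V 0) ^ 2 ≤ 0 := by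
  have eu : ∀ᶠ s in 𝓝 0, 0 < a - u s :=
    (continuousAt_const.sub (hu 0).continuousAt).eventually_const_lt hu0
  have eφ : ∀ᶠ s in 𝓝 0, 0 < φ s := (hφ 0).continuousAt.eventually_const_lt hφ0
  have eV : ∀ᶠ s in 𝓝 0, 0 < 1 - c * V s :=
    (continuousAt_const.sub (continuousAt_const.mul (hV 0).continuousAt)).eventually_const_lt hV0
  have h1 : ∀ᶠ s in 𝓝 0, HasDerivAt
      (fun s => α * Real.log (a - u s) + Real.log (φ s) - Real.log (1 - c * V s))
      (-(α * u1 s / (a - u s)) + φ1 s / φ s + c * V1 s / (1 - c * V s)) s := by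
    filter_upwards [eu, eφ, eV] with s h h' h''
    exact hasDerivAt_logTest (hu s) (hφ s) (hV s) h h' h''
  have h2 := (((hu'.const_mul α).fun_div ((hu 0).const_sub a) hu0.ne').fun_neg.fun_add
    (hφ'.fun_div (hφ 0) hφ0.ne')).fun_add
    ((hV'.const_mul c).fun_div (((hV 0).const_mul c).const_sub 1) hV0.ne')
  obtain ⟨e1, e2⟩ := derivs_of_isLocalMax hmax h1 h2
  refine ⟨e1, le_of_eq_of_le ?_ e2⟩
  generalize u 0 = x at *
  field_simp
  ring

/-- A one-sided maximum in the past gives a nonnegative derivative. -/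
lemma deriv_nonneg_of_le_past {ζ : ℝ → ℝ} {k : ℝ} (h : HasDerivAt ζ k 0)
    (hmax : ∀ᶠ s in 𝓝 (0 : ℝ), s ≤ 0 → ζ s ≤ ζ 0) : 0 ≤ k := by
  have h1 := h.hasDerivWithinAt (s := Set.Iio 0)
  rw [hasDerivWithinAt_iff_tendsto_slope' (by simp)] at h1
  refine ge_of_tendsto h1 ?_
  filter_upwards [nhdsWithin_le_nhds hmax, self_mem_nhdsWithin] with s hs hs0
  rw [slope_def_field]
  exact div_nonneg_of_nonpos (by linarith [hs (le_of_lt hs0)]) (by simpa using le_of_lt hs0)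

end LogTest

/-- The derivatives of the area element along a line. -/
lemma hasDerivAt_sqrt_one_add_sum_sq {n : ℕ} {p p1 : Fin n → ℝ → ℝ} {p2 : Fin n → ℝ}
    (hp : ∀ i s, HasDerivAt (p i) (p1 i s) s) (hp' : ∀ i, HasDerivAt (p1 i) (p2 i) 0) :
    (∀ s, HasDerivAt (fun s => √(1 + ∑ i, p i s ^ 2))
      ((∑ i, p i s * p1 i s) / √(1 + ∑ i, p i s ^ 2)) s) ∧
    HasDerivAt (fun s => (∑ i, p i s * p1 i s) / √(1 + ∑ i, p i s ^ 2))
      (((∑ i, p1 i 0 ^ 2) + ∑ i, p i 0 * p2 i) / √(1 + ∑ i, p i 0 ^ 2)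
        - (∑ i, p i 0 * p1 i 0) ^ 2 / √(1 + ∑ i, p i 0 ^ 2) ^ 3) 0 := by
  have hpos : ∀ s, 0 < 1 + ∑ i, p i s ^ 2 := fun s =>
    add_pos_of_pos_of_nonneg one_pos (Finset.sum_nonneg fun i _ => sq_nonneg _)
  have hV : ∀ s, HasDerivAt (fun s => √(1 + ∑ i, p i s ^ 2))
      ((∑ i, p i s * p1 i s) / √(1 + ∑ i, p i s ^ 2)) s := by
    intro s
    have h := ((HasDerivAt.fun_sum (u := Finset.univ) fun i _ => (hp i s).fun_pow 2).const_add
      1).sqrt (hpos s).ne'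
    refine h.congr_deriv ?_
    have : ∑ i, (2 : ℕ) * p i s ^ (2 - 1) * p1 i s = 2 * ∑ i, p i s * p1 i s := by
      rw [Finset.mul_sum]
      exact Finset.sum_congr rfl fun i _ => by push_cast; ring
    rw [this]
    exact mul_div_mul_left _ _ two_ne_zero
  refine ⟨hV, ?_⟩
  have hpos' : 0 < √(1 + ∑ i, p i 0 ^ 2) := Real.sqrt_pos.2 (hpos 0)
  have h := (HasDerivAt.fun_sum (u := Finset.univ) fun i _ => (hp i 0).fun_mul (hp' i)).fun_div
    (hV 0) hpos'.ne'
  refine h.congr_deriv ?_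
  have : ∑ i, (p1 i 0 * p1 i 0 + p i 0 * p2 i) = (∑ i, p1 i 0 ^ 2) + ∑ i, p i 0 * p2 i := by
    rw [← Finset.sum_add_distrib]
    exact Finset.sum_congr rfl fun i _ => by ring
  rw [this]
  field_simp

/-! ### Space-time calculus, the linearised flow and the interior maximum. -/

section Spacetime

variable {n : ℕ}

/-- The spatial coordinate directions of space-time. -/
noncomputable def spaceDir (i : Fin n) : EuclideanSpace ℝ (Fin n) × ℝ :=
  (EuclideanSpace.single i 1, 0)

/-- The time direction of space-time. -/
noncomputable def timeDir : EuclideanSpace ℝ (Fin n) × ℝ := (0, 1)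

/-- The spatial gradient, as a coordinate vector. -/
noncomputable def spaceGrad (f : EuclideanSpace ℝ (Fin n) × ℝ → ℝ)
    (z : EuclideanSpace ℝ (Fin n) × ℝ) : Fin n → ℝ :=
  fun i => dirDeriv (spaceDir i) f z

/-- The spatial Hessian, as a matrix. -/
noncomputable def spaceHess (f : EuclideanSpace ℝ (Fin n) × ℝ → ℝ)
    (z : EuclideanSpace ℝ (Fin n) × ℝ) : Matrix (Fin n) (Fin n) ℝ :=
  Matrix.of fun i j => dirDeriv (spaceDir i) (dirDeriv (spaceDir j) f) z

/-- The square of the area element of the graph of `f(·, t)`. -/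
noncomputable def areaSq (f : EuclideanSpace ℝ (Fin n) × ℝ → ℝ)
    (z : EuclideanSpace ℝ (Fin n) × ℝ) : ℝ :=
  1 + ∑ i, spaceGrad f z i ^ 2

variable {f : EuclideanSpace ℝ (Fin n) × ℝ → ℝ}

lemma areaSq_eq_dotProduct (z : EuclideanSpace ℝ (Fin n) × ℝ) :
    areaSq f z = 1 + spaceGrad f z ⬝ᵥ spaceGrad f z := by
  simp [areaSq, dotProduct, sq]

lemma one_le_areaSq (z : EuclideanSpace ℝ (Fin n) × ℝ) : 1 ≤ areaSq f z :=
  le_add_of_nonneg_right (Finset.sum_nonneg fun _ _ => sq_nonneg _)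

lemma spaceHess_transpose (hf : ContDiff ℝ ∞ f) (z : EuclideanSpace ℝ (Fin n) × ℝ) :
    (spaceHess f z)ᵀ = spaceHess f z := by
  ext i j
  simp only [spaceHess, transpose_apply, of_apply]
  rw [dirDeriv_comm hf]

/-- The quadratic form of the Hessian is the second derivative in a spatial direction. -/
lemma dirDeriv_dirDeriv_sum_spaceDir (hf : ContDiff ℝ ∞ f) (ξ : Fin n → ℝ)
    (z : EuclideanSpace ℝ (Fin n) × ℝ) :
    dirDeriv (∑ i, ξ i • spaceDir i) (dirDeriv (∑ i, ξ i • spaceDir i) f) z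
      = ξ ⬝ᵥ spaceHess f z *ᵥ ξ := by
  rw [dirDeriv_sum_smul, dirDeriv_sum_smul]
  simp only [dotProduct, mulVec, spaceHess, of_apply]
  refine Finset.sum_congr rfl fun i _ => ?_
  rw [dirDeriv_sum_const_mul _ _ fun j => contDiff_dirDeriv hf _]
  simp only [mul_comm]

lemma dirDeriv_sum_spaceDir (ξ : Fin n → ℝ) (z : EuclideanSpace ℝ (Fin n) × ℝ) :
    dirDeriv (∑ i, ξ i • spaceDir i) f z = ξ ⬝ᵥ spaceGrad f z := by
  rw [dirDeriv_sum_smul]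
  rfl

lemma dirDeriv_sum_spaceDir_spaceDir (hf : ContDiff ℝ ∞ f) (ξ : Fin n → ℝ) (i : Fin n)
    (z : EuclideanSpace ℝ (Fin n) × ℝ) :
    dirDeriv (∑ j, ξ j • spaceDir j) (dirDeriv (spaceDir i) f) z = (spaceHess f z *ᵥ ξ) i := by
  rw [dirDeriv_comm hf, dirDeriv_sum_smul,
    dirDeriv_sum_const_mul _ _ fun j => contDiff_dirDeriv hf _]
  simp only [dotProduct, mulVec, spaceHess, of_apply, mul_comm]

/-- The linearisation of the flow equation, solved for the mean curvature, in the direction of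
an arbitrary space-time vector. -/
lemma linearized_flow {β : ℝ} (hf : ContDiff ℝ ∞ f) {z : EuclideanSpace ℝ (Fin n) × ℝ}
    (hφ : 0 < dirDeriv timeDir f z)
    (hpde : ∀ᶠ y in 𝓝 z, areaSq f y * (spaceHess f y).trace
      - spaceGrad f y ⬝ᵥ spaceHess f y *ᵥ spaceGrad f y
        = areaSq f y ^ ((3 - β) / 2) * dirDeriv timeDir f y ^ β)
    (τ : EuclideanSpace ℝ (Fin n) × ℝ) :
    2 * (spaceGrad f z ⬝ᵥ spaceGrad (dirDeriv τ f) z) * (spaceHess f z).trace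
      + areaSq f z * (spaceHess (dirDeriv τ f) z).trace
      - spaceGrad f z ⬝ᵥ spaceHess (dirDeriv τ f) z *ᵥ spaceGrad f z
      - 2 * (spaceGrad (dirDeriv τ f) z ⬝ᵥ spaceHess f z *ᵥ spaceGrad f z)
    = 2 * (spaceGrad f z ⬝ᵥ spaceGrad (dirDeriv τ f) z) * ((3 - β) / 2)
        * areaSq f z ^ ((3 - β) / 2 - 1) * dirDeriv timeDir f z ^ β
      + areaSq f z ^ ((3 - β) / 2) * (dirDeriv timeDir (dirDeriv τ f) z * β
        * dirDeriv timeDir f z ^ (β - 1)) := by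
  have hp : ∀ i, HasDerivAt (fun s : ℝ => spaceGrad f (z + s • τ) i)
      (spaceGrad (dirDeriv τ f) z i) 0 := fun i => by
    refine (hasDerivAt_comp_line_zero (contDiff_dirDeriv hf (spaceDir i)) z τ).congr_deriv ?_
    rw [spaceGrad, dirDeriv_comm hf]
  have hr : ∀ i j, HasDerivAt (fun s : ℝ => spaceHess f (z + s • τ) i j)
      (spaceHess (dirDeriv τ f) z i j) 0 := fun i j => by
    refine (hasDerivAt_comp_line_zero (contDiff_dirDeriv (contDiff_dirDeriv hf (spaceDir j))
      (spaceDir i)) z τ).congr_deriv ?_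
    rw [spaceHess, of_apply, dirDeriv_comm (contDiff_dirDeriv hf _), dirDeriv_comm hf τ]
  have hφ1 : HasDerivAt (fun s : ℝ => dirDeriv timeDir f (z + s • τ))
      (dirDeriv timeDir (dirDeriv τ f) z) 0 := by
    refine (hasDerivAt_comp_line_zero (contDiff_dirDeriv hf timeDir) z τ).congr_deriv ?_
    rw [dirDeriv_comm hf]
  have z0 : z + (0 : ℝ) • τ = z := by simp
  have hP : HasDerivAt (fun s : ℝ => areaSq f (z + s • τ))
      (2 * (spaceGrad f z ⬝ᵥ spaceGrad (dirDeriv τ f) z)) 0 := by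
    refine ((HasDerivAt.fun_sum (u := Finset.univ) fun i _ => (hp i).fun_pow 2).const_add
      1).congr_deriv ?_
    rw [dotProduct, Finset.mul_sum, z0]
    exact Finset.sum_congr rfl fun i _ => by push_cast; ring
  have htr : HasDerivAt (fun s : ℝ => (spaceHess f (z + s • τ)).trace)
      (spaceHess (dirDeriv τ f) z).trace 0 :=
    HasDerivAt.fun_sum fun i _ => hr i i
  have hq : HasDerivAt (fun s : ℝ =>
      spaceGrad f (z + s • τ) ⬝ᵥ spaceHess f (z + s • τ) *ᵥ spaceGrad f (z + s • τ))
      (spaceGrad f z ⬝ᵥ spaceHess (dirDeriv τ f) z *ᵥ spaceGrad f z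
        + 2 * (spaceGrad (dirDeriv τ f) z ⬝ᵥ spaceHess f z *ᵥ spaceGrad f z)) 0 := by
    have h := HasDerivAt.fun_sum (u := Finset.univ) fun i _ => (hp i).fun_mul
      (HasDerivAt.fun_sum (u := Finset.univ) fun j _ => (hr i j).fun_mul (hp j))
    refine h.congr_deriv ?_
    rw [z0]
    have hsym : spaceGrad f z ⬝ᵥ spaceHess f z *ᵥ spaceGrad (dirDeriv τ f) z
        = spaceGrad (dirDeriv τ f) z ⬝ᵥ spaceHess f z *ᵥ spaceGrad f z := by
      rw [dotProduct_mulVec, ← mulVec_transpose, spaceHess_transpose hf, dotProduct_comm]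
    rw [two_mul]
    conv_rhs => enter [2, 2]; rw [← hsym]
    simp only [Finset.sum_add_distrib, mul_add]
    simp only [dotProduct, mulVec]
    ring
  have hL := (hP.fun_mul htr).fun_sub hq
  have hR := (hP.rpow_const (p := (3 - β) / 2)
    (Or.inl (by linarith [one_le_areaSq (f := f) (z + (0 : ℝ) • τ)]))).fun_mul
    (hφ1.rpow_const (p := β) (Or.inl (by rw [z0]; exact hφ.ne')))
  -- The equation holds near `z`, hence along the line for small `s`, and the derivatives of its two
  -- sides at `s = 0` agree.
  have heq := ((tendsto_line z τ).eventually hpde)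
  have := hL.unique (hR.congr_of_eventuallyEq heq)
  rw [z0] at this
  linarith

/-- The bound for `ψ H` at an interior maximum of the test function. -/
lemma mul_curvature_le_of_interior_max {α a c H : ℝ} (hα : 0 < α) (hc : 0 < c)
    (hf : ContDiff ℝ ∞ f) {z : EuclideanSpace ℝ (Fin n) × ℝ} (hψ : f z < a)
    (hcv : 2 * (c * √(areaSq f z)) ≤ 1) (hH : 0 < H)
    (hflow : dirDeriv timeDir f z = √(areaSq f z) * H ^ α)
    (hpde : ∀ᶠ y in 𝓝 z, areaSq f y * (spaceHess f y).trace
      - spaceGrad f y ⬝ᵥ spaceHess f y *ᵥ spaceGrad f y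
        = areaSq f y ^ ((3 - α⁻¹) / 2) * dirDeriv timeDir f y ^ α⁻¹)
    (hmax : ∀ᶠ y in 𝓝 z, y.2 ≤ z.2 →
      α * Real.log (a - f y) + Real.log (dirDeriv timeDir f y) - Real.log (1 - c * √(areaSq f y))
      ≤ α * Real.log (a - f z) + Real.log (dirDeriv timeDir f z)
        - Real.log (1 - c * √(areaSq f z))) :
    (a - f z) * H ≤ curvatureBound n α c := by
  set v := √(areaSq f z) with hvdef
  have hP0 : 0 < areaSq f z := by linarith [one_le_areaSq (f := f) z]
  have hv : 0 < v := Real.sqrt_pos.2 hP0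
  have hv2 : v ^ 2 = areaSq f z := Real.sq_sqrt hP0.le
  have hφ : 0 < dirDeriv timeDir f z := by rw [hflow]; positivity
  set φ := dirDeriv timeDir f z with hφdef
  set p := spaceGrad f z with hp
  set r := spaceHess f z with hr
  set q := spaceGrad (dirDeriv timeDir f) z with hq
  set γ := H ^ (1 - α) with hγ
  have hγ0 : 0 < γ := by positivity
  have hPpow : ∀ x : ℝ, areaSq f z ^ x = v ^ (2 * x) := fun x => by
    rw [← hv2, ← Real.rpow_natCast, ← Real.rpow_mul hv.le]; norm_num
  have hHα : (H ^ α) ^ α⁻¹ = H := by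
    rw [← Real.rpow_mul hH.le, mul_inv_cancel₀ hα.ne', Real.rpow_one]
  have hφβ : φ ^ α⁻¹ = v ^ α⁻¹ * H := by
    rw [hflow, Real.mul_rpow hv.le (by positivity), hHα]
  have hφβ1 : φ ^ (α⁻¹ - 1) = v ^ (α⁻¹ - 1) * γ := by
    rw [hflow, Real.mul_rpow hv.le (by positivity), ← Real.rpow_mul hH.le, mul_sub,
      mul_inv_cancel₀ hα.ne', mul_one]
  -- Since `φ = v H^α`, one has `φ^β = v^β H` and `φ^(β-1) = v^(β-1) γ` with `β = α⁻¹`. In each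
  -- product the exponents of `v` then add up to an integer.
  have k1 : areaSq f z ^ ((3 - α⁻¹) / 2) * φ ^ α⁻¹ = v ^ 3 * H := by
    rw [hPpow, hφβ, ← mul_assoc, ← Real.rpow_add hv, ← Real.rpow_natCast]
    congr 2; push_cast; ring
  have k2 : areaSq f z ^ ((3 - α⁻¹) / 2 - 1) * φ ^ α⁻¹ = v * H := by
    rw [hPpow, hφβ, ← mul_assoc, ← Real.rpow_add hv]
    congr 1
    convert Real.rpow_one v using 2; ring
  have k3 : areaSq f z ^ ((3 - α⁻¹) / 2) * φ ^ (α⁻¹ - 1) = v ^ 2 * γ := by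
    rw [hPpow, hφβ1, ← mul_assoc, ← Real.rpow_add hv, ← Real.rpow_natCast]
    congr 2; push_cast; ring
  have hlin := linearized_flow hf hφ hpde
  -- The coefficients `p` are frozen at `z`. The Hessian of this function is thus exactly the
  -- contraction of `p` with the third derivatives of `u`, as it occurs in the Hessian of `v`.
  have hη : dirDeriv (∑ i, p i • spaceDir i) f = fun y => ∑ i, p i * dirDeriv (spaceDir i) f y :=
    dirDeriv_sum_smul _ _ _ _
  have hηg : spaceGrad (dirDeriv (∑ i, p i • spaceDir i) f) z = r *ᵥ p := by
    ext i
    rw [spaceGrad, dirDeriv_comm hf, dirDeriv_sum_spaceDir_spaceDir hf]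
  have hηt : dirDeriv timeDir (dirDeriv (∑ i, p i • spaceDir i) f) z = p ⬝ᵥ q := by
    rw [dirDeriv_comm hf, dirDeriv_sum_spaceDir]
  -- the maximum along lines
  have hV : ∀ y, √(areaSq f y) = √(1 + ∑ i, dirDeriv (spaceDir i) f y ^ 2) := fun y => rfl
  have hline : ∀ ξ : Fin n → ℝ,
      -(α * (ξ ⬝ᵥ p) / (a - f z)) + ξ ⬝ᵥ q / φ + c * (ξ ⬝ᵥ r *ᵥ p / v) / (1 - c * v) = 0 ∧
      -(α * (ξ ⬝ᵥ r *ᵥ ξ) / (a - f z)) - α * (ξ ⬝ᵥ p) ^ 2 / (a - f z) ^ 2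
      + (ξ ⬝ᵥ spaceHess (dirDeriv timeDir f) z *ᵥ ξ) / φ - (ξ ⬝ᵥ q) ^ 2 / φ ^ 2
      + c * ((ξ ⬝ᵥ (r * r) *ᵥ ξ + ξ ⬝ᵥ spaceHess (dirDeriv (∑ i, p i • spaceDir i) f) z *ᵥ ξ) / v
        - (ξ ⬝ᵥ r *ᵥ p) ^ 2 / v ^ 3) / (1 - c * v)
      + c ^ 2 * ((ξ ⬝ᵥ r *ᵥ p) / v) ^ 2 / (1 - c * v) ^ 2 ≤ 0 := fun ξ => by
    -- A spatial direction keeps time fixed, so the maximum over the past restricts to a genuine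
    -- local maximum along the line.
    set τ := ∑ i, ξ i • spaceDir i with hτ
    have hτ2 : τ.2 = 0 := by simp [hτ, spaceDir, Prod.snd_sum]
    have hm : IsLocalMax (fun s : ℝ => α * Real.log (a - f (z + s • τ))
        + Real.log (dirDeriv timeDir f (z + s • τ))
        - Real.log (1 - c * √(1 + ∑ i, dirDeriv (spaceDir i) f (z + s • τ) ^ 2))) 0 := by
      filter_upwards [(tendsto_line z τ).eventually hmax] with s hs
      have := hs (by simp [hτ2])
      simp only [zero_smul, add_zero]
      exact this
    have hV1 := hasDerivAt_sqrt_one_add_sum_sq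
      (p := fun i s => dirDeriv (spaceDir i) f (z + s • τ))
      (fun i s => hasDerivAt_comp_line (contDiff_dirDeriv hf (spaceDir i)) z τ s)
      (fun i => hasDerivAt_comp_line_zero (contDiff_dirDeriv (contDiff_dirDeriv hf (spaceDir i)) τ)
        z τ)
    have key := derivs_of_isLocalMax_logTest
      (hasDerivAt_comp_line hf z τ)
      (hasDerivAt_comp_line_zero (contDiff_dirDeriv hf τ) z τ)
      (hasDerivAt_comp_line (contDiff_dirDeriv hf timeDir) z τ)
      (hasDerivAt_comp_line_zero (contDiff_dirDeriv (contDiff_dirDeriv hf timeDir) τ) z τ)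
      hV1.1 hV1.2 (by simpa using hψ) (by simpa using hφ)
      (by simp only [zero_smul, add_zero, ← hV]; linarith) hm
    have e1 : ∑ i, dirDeriv (spaceDir i) f z * dirDeriv τ (dirDeriv (spaceDir i) f) z
        = ξ ⬝ᵥ r *ᵥ p := by
      rw [dotProduct_mulVec, ← mulVec_transpose, hr, spaceHess_transpose hf, dotProduct_comm]
      simp only [hτ, dirDeriv_sum_spaceDir_spaceDir hf]
      rfl
    have e2 : ∑ i, dirDeriv τ (dirDeriv (spaceDir i) f) z ^ 2 = ξ ⬝ᵥ (r * r) *ᵥ ξ := by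
      rw [← mulVec_mulVec, dotProduct_mulVec, ← mulVec_transpose, hr, spaceHess_transpose hf]
      simp only [hτ, dirDeriv_sum_spaceDir_spaceDir hf, sq]
      rfl
    have e3 : ∑ i, dirDeriv (spaceDir i) f z * dirDeriv τ (dirDeriv τ (dirDeriv (spaceDir i) f)) z
        = ξ ⬝ᵥ spaceHess (dirDeriv (∑ i, p i • spaceDir i) f) z *ᵥ ξ := by
      rw [← dirDeriv_dirDeriv_sum_spaceDir (contDiff_dirDeriv hf _), hη,
        dirDeriv_sum_const_mul _ _ fun j => contDiff_dirDeriv hf _,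
        dirDeriv_sum_const_mul _ _ fun j => contDiff_dirDeriv (contDiff_dirDeriv hf _) _]
      rfl
    simp only [zero_smul, add_zero, e1, e2, e3, ← hV] at key
    rw [dirDeriv_dirDeriv_sum_spaceDir hf,
      dirDeriv_dirDeriv_sum_spaceDir (contDiff_dirDeriv hf _), dirDeriv_sum_spaceDir,
      dirDeriv_sum_spaceDir] at key
    exact key
  have htime : 0 ≤ -(α * φ / (a - f z)) + dirDeriv timeDir (dirDeriv timeDir f) z / φ
      + c * (p ⬝ᵥ q / v) / (1 - c * v) := by
    have hV1 := (hasDerivAt_sqrt_one_add_sum_sq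
      (p := fun i s => dirDeriv (spaceDir i) f (z + s • timeDir))
      (fun i s => hasDerivAt_comp_line (contDiff_dirDeriv hf (spaceDir i)) z timeDir s)
      (fun i => hasDerivAt_comp_line_zero
        (contDiff_dirDeriv (contDiff_dirDeriv hf (spaceDir i)) timeDir) z timeDir)).1 0
    have key := hasDerivAt_logTest (α := α) (a := a) (c := c) (hasDerivAt_comp_line hf z timeDir 0)
      (hasDerivAt_comp_line (contDiff_dirDeriv hf timeDir) z timeDir 0)
      hV1 (by simpa using hψ) (by simpa using hφ)
      (by simp only [zero_smul, add_zero, ← hV]; linarith)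
    have hk := deriv_nonneg_of_le_past key (by
      filter_upwards [(tendsto_line z timeDir).eventually hmax] with s hs hs0
      have := hs (by simpa [timeDir] using hs0)
      simp only [zero_smul, add_zero]
      exact this)
    have e1 : ∑ i, dirDeriv (spaceDir i) f z * dirDeriv timeDir (dirDeriv (spaceDir i) f) z
        = p ⬝ᵥ q := by
      refine Finset.sum_congr rfl fun i _ => ?_
      rw [dirDeriv_comm hf]
      rfl
    simp only [zero_smul, add_zero, e1, ← hV] at hk
    exact hk
  have hlint := hlin timeDir
  have hlinp := hlin (∑ i, p i • spaceDir i)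
  rw [hηg, hηt] at hlinp
  refine mul_curvature_le_of_isMax (Φ := spaceHess (dirDeriv timeDir f) z)
    (E := spaceHess (dirDeriv (∑ i, p i • spaceDir i) f) z) (q := q) (r := r)
    hα (mul_inv_cancel₀ hα.ne') hc hv (hv2.trans (areaSq_eq_dotProduct z)) hcv (sub_pos.2 hψ) hφ hH
    hγ0 ?_ (spaceHess_transpose hf z) ?_ ?_ ?_ (fun i => ?_) htime (fun ξ => (hline ξ).2)
  · rw [hflow, hγ, mul_left_comm, ← Real.rpow_add hH, sub_add_cancel, Real.rpow_one]
  · rw [← k1, hv2]; exact hpde.self_of_nhds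
  · rw [hv2]
    refine hlint.trans ?_
    linear_combination ((p ⬝ᵥ q) * (3 - α⁻¹)) * k2
      + (dirDeriv timeDir (dirDeriv timeDir f) z * α⁻¹) * k3
      + (α⁻¹ * γ * dirDeriv timeDir (dirDeriv timeDir f) z) * hv2
  · rw [hv2]
    refine hlinp.trans ?_
    linear_combination ((p ⬝ᵥ r *ᵥ p) * (3 - α⁻¹)) * k2
      + ((p ⬝ᵥ q) * α⁻¹) * k3 + (α⁻¹ * γ * (p ⬝ᵥ q)) * hv2
  · have := (hline (Pi.single i 1)).1
    simpa only [single_dotProduct, one_mul] using this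

end Spacetime

/-! ### Local smooth extension and the mean curvature in coordinates. -/

/-- A smooth function on a neighbourhood of a point extends, locally, to a smooth function. -/
lemma exists_contDiff_eventuallyEq {X : Type*} [NormedAddCommGroup X] [NormedSpace ℝ X]
    [FiniteDimensional ℝ X] {f : X → ℝ} {O : Set X} (hO : IsOpen O) (hf : ContDiffOn ℝ ∞ f O)
    {x : X} (hx : x ∈ O) : ∃ g : X → ℝ, ContDiff ℝ ∞ g ∧ g =ᶠ[𝓝 x] f := by
  obtain ⟨ε, hε, hball⟩ := Metric.isOpen_iff.1 hO x hx
  let b : ContDiffBump x := ⟨ε / 4, ε / 2, by positivity, by linarith⟩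
  refine ⟨fun y => b y * f y, contDiff_iff_contDiffAt.2 fun y => ?_, ?_⟩
  · by_cases hy : y ∈ O
    · exact b.contDiff.contDiffAt.mul (hf.contDiffAt (hO.mem_nhds hy))
    · have hy' : y ∉ tsupport b := fun h => hy (hball (by
        rw [b.tsupport_eq] at h
        exact lt_of_le_of_lt h (by change ε / 2 < ε; linarith)))
      have : (fun y => b y * f y) =ᶠ[𝓝 y] fun _ => 0 := by
        filter_upwards [notMem_tsupport_iff_eventuallyEq.1 hy'] with w hw
        simp [hw]
      exact contDiffAt_const.congr_of_eventuallyEq this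
  · filter_upwards [b.eventuallyEq_one] with y hy
    simp [hy]

section Coordinates

variable {n : ℕ}

lemma gradient_apply_eq_fderiv (g : EuclideanSpace ℝ (Fin n) → ℝ) (x : EuclideanSpace ℝ (Fin n))
    (i : Fin n) : gradient g x i = fderiv ℝ g x (EuclideanSpace.single i 1) := by
  rw [← inner_gradient_left, EuclideanSpace.inner_single_right]
  simp

lemma areaElement_eq_sqrt (g : EuclideanSpace ℝ (Fin n) → ℝ) (x : EuclideanSpace ℝ (Fin n)) :
    areaElement g x = √(1 + ∑ i, fderiv ℝ g x (EuclideanSpace.single i 1) ^ 2) := by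
  simp only [areaElement, EuclideanSpace.real_norm_sq_eq, gradient_apply_eq_fderiv]

lemma one_le_areaElement (g : EuclideanSpace ℝ (Fin n) → ℝ) (x : EuclideanSpace ℝ (Fin n)) :
    1 ≤ areaElement g x :=
  Real.one_le_sqrt.2 (le_add_of_nonneg_right (sq_nonneg _))

lemma areaElement_congr {f g : EuclideanSpace ℝ (Fin n) → ℝ} {x : EuclideanSpace ℝ (Fin n)}
    (h : f =ᶠ[𝓝 x] g) : areaElement f x = areaElement g x := by
  rw [areaElement_eq_sqrt, areaElement_eq_sqrt, h.fderiv_eq]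

lemma meanCurvature_congr {f g : EuclideanSpace ℝ (Fin n) → ℝ} {x : EuclideanSpace ℝ (Fin n)}
    (h : f =ᶠ[𝓝 x] g) : meanCurvature f x = meanCurvature g x := by
  have : (fun y => (1 / areaElement f y) • gradient f y)
      =ᶠ[𝓝 x] fun y => (1 / areaElement g y) • gradient g y := by
    filter_upwards [h.eventuallyEq_nhds] with y hy
    rw [areaElement_congr hy, gradient, gradient, hy.fderiv_eq]
  simp only [meanCurvature, divergence, this.fderiv_eq]

variable {f : EuclideanSpace ℝ (Fin n) × ℝ → ℝ}

lemma hasFDerivAt_slice (hf : ContDiff ℝ ∞ f) (t : ℝ) (x : EuclideanSpace ℝ (Fin n)) :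
    HasFDerivAt (fun y => f (y, t))
      ((fderiv ℝ f (x, t)).comp (ContinuousLinearMap.inl ℝ (EuclideanSpace ℝ (Fin n)) ℝ)) x :=
  ((hf.differentiable (by simp)) (x, t)).hasFDerivAt.comp x (hasFDerivAt_prodMk_left x t)

lemma areaElement_slice (hf : ContDiff ℝ ∞ f) (t : ℝ) (x : EuclideanSpace ℝ (Fin n)) :
    areaElement (fun y => f (y, t)) x = √(areaSq f (x, t)) := by
  rw [areaElement_eq_sqrt, (hasFDerivAt_slice hf t x).fderiv]
  rfl

lemma gradient_slice (hf : ContDiff ℝ ∞ f) (t : ℝ) (x : EuclideanSpace ℝ (Fin n)) (i : Fin n) :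
    gradient (fun y => f (y, t)) x i = spaceGrad f (x, t) i := by
  rw [gradient_apply_eq_fderiv, (hasFDerivAt_slice hf t x).fderiv]
  rfl

/-- The mean curvature of a graph in coordinates. -/
lemma meanCurvature_slice (hf : ContDiff ℝ ∞ f) (t : ℝ) (x : EuclideanSpace ℝ (Fin n)) :
    √(areaSq f (x, t)) ^ 3 * meanCurvature (fun y => f (y, t)) x
      = areaSq f (x, t) * (spaceHess f (x, t)).trace
        - spaceGrad f (x, t) ⬝ᵥ spaceHess f (x, t) *ᵥ spaceGrad f (x, t) := by
  set F : EuclideanSpace ℝ (Fin n) → EuclideanSpace ℝ (Fin n) :=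
    fun y => (1 / areaElement (fun y => f (y, t)) y) • gradient (fun y => f (y, t)) y with hF
  have hFi : ∀ i y, F y i
      = (1 / √(areaSq f (y, t))) * dirDeriv (spaceDir i) f (y, t) := fun i y => by
    simp only [hF, PiLp.smul_apply, smul_eq_mul, areaElement_slice hf, gradient_slice hf]
    rfl
  have hpos : ∀ z, 0 < areaSq f z := fun z => by linarith [one_le_areaSq (f := f) z]
  have hsmooth : ContDiff ℝ ∞ (areaSq f) :=
    contDiff_const.add (ContDiff.sum fun i _ => (contDiff_dirDeriv hf (spaceDir i)).pow 2)
  have hFd : DifferentiableAt ℝ F x := by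
    rw [differentiableAt_euclidean]
    intro i
    simp only [hFi, one_div]
    have hslice : ContDiff ℝ ∞ fun y : EuclideanSpace ℝ (Fin n) => (y, t) :=
      contDiff_id.prodMk contDiff_const
    have h1 : DifferentiableAt ℝ (fun y => areaSq f (y, t)) x :=
      ((hsmooth.comp hslice).differentiable (by simp)) x
    have h2 : DifferentiableAt ℝ (fun y => dirDeriv (spaceDir i) f (y, t)) x :=
      (((contDiff_dirDeriv hf (spaceDir i)).comp hslice).differentiable (by simp)) x
    have h3 := h1.sqrt (hpos (x, t)).ne'
    exact (h3.fun_inv (Real.sqrt_pos.2 (hpos (x, t))).ne').fun_mul h2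
  set z : EuclideanSpace ℝ (Fin n) × ℝ := (x, t) with hz
  set v := √(areaSq f z) with hv
  have hv0 : 0 < v := Real.sqrt_pos.2 (hpos _)
  have hv2 : v ^ 2 = areaSq f z := Real.sq_sqrt (hpos _).le
  have hline : ∀ (i : Fin n) (s : ℝ), ((x + s • EuclideanSpace.single i 1 : EuclideanSpace ℝ (Fin n)), t)
      = z + s • spaceDir i := fun i s => by simp [hz, spaceDir]
  have hcomp : ∀ i, (fderiv ℝ F x (EuclideanSpace.single i 1)) i
      = spaceHess f z i i / v
        - spaceGrad f z i * (∑ k, spaceGrad f z k * spaceHess f z i k) / v ^ 3 := by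
    intro i
    have h1 : HasDerivAt (fun s : ℝ => x + s • (EuclideanSpace.single i 1 : EuclideanSpace ℝ (Fin n)))
        (EuclideanSpace.single i 1) 0 := by
      simpa using ((hasDerivAt_id (0 : ℝ)).smul_const
        (EuclideanSpace.single i 1 : EuclideanSpace ℝ (Fin n))).const_add x
    have h2 : HasFDerivAt F (fderiv ℝ F x)
        (x + (0 : ℝ) • (EuclideanSpace.single i 1 : EuclideanSpace ℝ (Fin n))) := by
      simpa using hFd.hasFDerivAt
    have h3 := ((EuclideanSpace.proj i : EuclideanSpace ℝ (Fin n) →L[ℝ] ℝ).hasFDerivAt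
      (x := F (x + (0 : ℝ) • EuclideanSpace.single i 1))).comp_hasDerivAt (0 : ℝ)
      (h2.comp_hasDerivAt (0 : ℝ) h1)
    have hV := (hasDerivAt_sqrt_one_add_sum_sq
      (p := fun k s => dirDeriv (spaceDir k) f (z + s • spaceDir i))
      (fun k s => hasDerivAt_comp_line (contDiff_dirDeriv hf (spaceDir k)) z (spaceDir i) s)
      (fun k => hasDerivAt_comp_line_zero
        (contDiff_dirDeriv (contDiff_dirDeriv hf (spaceDir k)) (spaceDir i)) z (spaceDir i))).1 0
    have hV0 : √(1 + ∑ k, dirDeriv (spaceDir k) f (z + (0 : ℝ) • spaceDir i) ^ 2) ≠ 0 := by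
      rw [zero_smul, add_zero]
      exact hv0.ne'
    have h4 := ((hasDerivAt_const (0 : ℝ) (1 : ℝ)).fun_div hV hV0).fun_mul
      (hasDerivAt_comp_line (contDiff_dirDeriv hf (spaceDir i)) z (spaceDir i) 0)
    have h5 : (⇑(EuclideanSpace.proj i : EuclideanSpace ℝ (Fin n) →L[ℝ] ℝ) ∘
        (F ∘ fun s : ℝ => x + s • (EuclideanSpace.single i 1 : EuclideanSpace ℝ (Fin n))))
        = fun s : ℝ => 1 / √(1 + ∑ k, dirDeriv (spaceDir k) f (z + s • spaceDir i) ^ 2)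
          * dirDeriv (spaceDir i) f (z + s • spaceDir i) := by
      ext s
      change F (x + s • EuclideanSpace.single i 1) i = _
      rw [hFi, hline]
      rfl
    rw [h5] at h3
    have h6 := h3.unique h4
    have hv' : √(1 + ∑ k, dirDeriv (spaceDir k) f z ^ 2) = v := rfl
    simp only [zero_smul, add_zero, hv'] at h6
    refine Eq.trans h6 ?_
    simp only [spaceHess, spaceGrad, of_apply]
    field_simp
    ring
  have hH : meanCurvature (fun y => f (y, t)) x
      = ∑ i, (fderiv ℝ F x (EuclideanSpace.single i 1)) i := rfl
  -- Summing over `i` gives `H = tr D²u / v - D²u(∇u, ∇u) / v³`.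
  rw [hH, Finset.sum_congr rfl fun i _ => hcomp i, Finset.sum_sub_distrib, ← Finset.sum_div,
    ← Finset.sum_div, ← hv2]
  have e1 : ∑ i, spaceHess f z i i = (spaceHess f z).trace := rfl
  have e2 : ∑ i, spaceGrad f z i * (∑ k, spaceGrad f z k * spaceHess f z i k)
      = spaceGrad f z ⬝ᵥ spaceHess f z *ᵥ spaceGrad f z := by
    simp only [dotProduct, mulVec, mul_comm]
  rw [e1, e2]
  field_simp

end Coordinates

/-! ### Regularity and compactness of a local graphical flow. -/

lemma convex_timeInterval (T : EReal) : Convex ℝ (timeInterval T) := by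
  refine Set.OrdConnected.convex ⟨fun x hx y hy z hz => ⟨hx.1.trans hz.1, ?_⟩⟩
  exact lt_of_le_of_lt (EReal.coe_le_coe_iff.2 hz.2) hy.2

lemma exists_pos_mem_timeInterval {T : EReal} (hT : 0 < T) : ∃ b : ℝ, 0 < b ∧ (b : EReal) < T := by
  obtain ⟨q, hq0, hq⟩ := EReal.lt_iff_exists_real_btwn.1 hT
  exact ⟨q, by exact_mod_cast hq0, hq⟩

lemma timeInterval_mem_nhds {T : EReal} {t : ℝ} (ht : t ∈ timeInterval T) (h0 : 0 < t) :
    timeInterval T ∈ 𝓝 t := by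
  have h2 : ∀ᶠ s : ℝ in 𝓝 t, (s : EReal) < T :=
    (continuous_coe_real_ereal.tendsto t).eventually_lt_const ht.2
  filter_upwards [lt_mem_nhds h0, h2] with s hs hs2 using ⟨hs.le, hs2⟩

lemma uniqueDiffOn_timeInterval {T : EReal} (hT : 0 < T) : UniqueDiffOn ℝ (timeInterval T) := by
  obtain ⟨b, hb0, hb⟩ := exists_pos_mem_timeInterval hT
  refine uniqueDiffOn_convex (convex_timeInterval T) ⟨b, ?_⟩
  exact mem_interior_iff_mem_nhds.2 (timeInterval_mem_nhds ⟨hb0.le, hb⟩ hb0)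

namespace IsLocalGraphicalFlow

variable {n : ℕ} {α a : ℝ} {T : EReal} {Ω : Set (EuclideanSpace ℝ (Fin n) × ℝ)}
  {u : EuclideanSpace ℝ (Fin n) → ℝ → ℝ}

lemma mem_timeInterval (h : IsLocalGraphicalFlow α a T Ω u)
    {p : EuclideanSpace ℝ (Fin n) × ℝ} (hp : p ∈ Ω) : p.2 ∈ timeInterval T := by
  obtain ⟨O, -, rfl⟩ := h.relOpen
  exact hp.2.2

lemma exists_isOpen_below (h : IsLocalGraphicalFlow α a T Ω u) (c : ℝ) :
    ∃ O : Set (EuclideanSpace ℝ (Fin n) × ℝ), IsOpen O ∧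
      below Ω u c = O ∩ (Set.univ ×ˢ timeInterval T) := by
  obtain ⟨O, hO, hΩ⟩ := h.relOpen
  obtain ⟨V, hV, hVe⟩ := continuousOn_iff'.1 h.continuousOn (Set.Iio c) isOpen_Iio
  refine ⟨V ∩ O, hV.inter hO, ?_⟩
  have : below Ω u c = (fun p : EuclideanSpace ℝ (Fin n) × ℝ => u p.1 p.2) ⁻¹' Set.Iio c ∩ Ω := by
    ext p
    exact and_comm
  rw [this, hVe, hΩ, Set.inter_assoc]

lemma below_mem_nhdsWithin (h : IsLocalGraphicalFlow α a T Ω u) {c : ℝ}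
    {p : EuclideanSpace ℝ (Fin n) × ℝ} (hp : p ∈ below Ω u c) :
    below Ω u c ∈ 𝓝[Set.univ ×ˢ timeInterval T] p := by
  obtain ⟨O, hO, hB⟩ := h.exists_isOpen_below c
  rw [hB] at hp ⊢
  exact inter_mem (mem_nhdsWithin_of_mem_nhds (hO.mem_nhds hp.1)) self_mem_nhdsWithin

lemma below_mem_nhds (h : IsLocalGraphicalFlow α a T Ω u) {c : ℝ}
    {p : EuclideanSpace ℝ (Fin n) × ℝ} (hp : p ∈ below Ω u c) (h0 : 0 < p.2) :
    below Ω u c ∈ 𝓝 p := by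
  have := h.below_mem_nhdsWithin hp
  rwa [nhdsWithin_eq_nhds.2] at this
  exact prod_mem_nhds univ_mem (timeInterval_mem_nhds (h.mem_timeInterval hp.1) h0)

lemma uniqueDiffOn_below (h : IsLocalGraphicalFlow α a T Ω u) (hT : 0 < T) (c : ℝ) :
    UniqueDiffOn ℝ (below Ω u c) := by
  obtain ⟨O, hO, hB⟩ := h.exists_isOpen_below c
  rw [hB, Set.inter_comm]
  exact (uniqueDiffOn_univ.prod (uniqueDiffOn_timeInterval hT)).inter hO

/-- The space-time derivative of `u` on the smooth part. -/
lemma hasFDerivWithinAt (h : IsLocalGraphicalFlow α a T Ω u)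
    {p : EuclideanSpace ℝ (Fin n) × ℝ} (hp : p ∈ below Ω u (a + 1)) :
    HasFDerivWithinAt (fun p : EuclideanSpace ℝ (Fin n) × ℝ => u p.1 p.2)
      (fderivWithin ℝ (fun p : EuclideanSpace ℝ (Fin n) × ℝ => u p.1 p.2) (below Ω u (a + 1)) p)
      (Set.univ ×ˢ timeInterval T) p :=
  (((h.smooth.differentiableOn (by simp)) p hp).hasFDerivWithinAt).mono_of_mem_nhdsWithin
    (h.below_mem_nhdsWithin hp)

lemma hasFDerivAt_slice (h : IsLocalGraphicalFlow α a T Ω u)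
    {p : EuclideanSpace ℝ (Fin n) × ℝ} (hp : p ∈ below Ω u (a + 1)) :
    HasFDerivAt (fun y => u y p.2)
      ((fderivWithin ℝ (fun p : EuclideanSpace ℝ (Fin n) × ℝ => u p.1 p.2)
        (below Ω u (a + 1)) p).comp
        (ContinuousLinearMap.inl ℝ (EuclideanSpace ℝ (Fin n)) ℝ)) p.1 :=
  (h.hasFDerivWithinAt hp).comp_hasFDerivAt (f := fun y => (y, p.2)) p.1
    (hasFDerivAt_prodMk_left p.1 p.2)
    (Eventually.of_forall fun _ => ⟨trivial, h.mem_timeInterval (p := p) hp.1⟩)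

lemma hasDerivWithinAt_time (h : IsLocalGraphicalFlow α a T Ω u)
    {p : EuclideanSpace ℝ (Fin n) × ℝ} (hp : p ∈ below Ω u (a + 1)) :
    HasDerivWithinAt (fun s => u p.1 s)
      (fderivWithin ℝ (fun p : EuclideanSpace ℝ (Fin n) × ℝ => u p.1 p.2)
        (below Ω u (a + 1)) p (0, 1)) (timeInterval T) p.2 := by
  have h1 : HasDerivWithinAt (fun s : ℝ => (p.1, s)) ((0 : EuclideanSpace ℝ (Fin n)), (1 : ℝ))
      (timeInterval T) p.2 :=
    (hasDerivWithinAt_const _ _ _).prodMk (hasDerivWithinAt_id _ _)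
  have hmaps : Set.MapsTo (fun s : ℝ => (p.1, s)) (timeInterval T)
      (Set.univ ×ˢ timeInterval T) := fun s hs => ⟨trivial, hs⟩
  exact (h.hasFDerivWithinAt hp).comp_hasDerivWithinAt p.2 h1 hmaps

/-- The speed of the graph, in the vertical direction. -/
lemma derivWithin_eq (h : IsLocalGraphicalFlow α a T Ω u)
    {p : EuclideanSpace ℝ (Fin n) × ℝ} (hp : p ∈ below Ω u (a + 1)) :
    derivWithin (fun s => u p.1 s) (timeInterval T) p.2
      = areaElement (fun y => u y p.2) p.1 * meanCurvature (fun y => u y p.2) p.1 ^ α := by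
  rw [← h.flow p hp, mul_div_cancel₀]
  linarith [one_le_areaElement (fun y => u y p.2) p.1]

lemma derivWithin_pos (h : IsLocalGraphicalFlow α a T Ω u)
    {p : EuclideanSpace ℝ (Fin n) × ℝ} (hp : p ∈ below Ω u (a + 1)) :
    0 < derivWithin (fun s => u p.1 s) (timeInterval T) p.2 := by
  rw [h.derivWithin_eq hp]
  exact mul_pos (by linarith [one_le_areaElement (fun y => u y p.2) p.1])
    (Real.rpow_pos_of_pos (h.meanConvex p hp) _)

lemma continuousOn_derivWithin (h : IsLocalGraphicalFlow α a T Ω u) (hT : 0 < T) :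
    ContinuousOn (fun p : EuclideanSpace ℝ (Fin n) × ℝ =>
      derivWithin (fun s => u p.1 s) (timeInterval T) p.2) (below Ω u (a + 1)) := by
  refine ((h.smooth.continuousOn_fderivWithin (h.uniqueDiffOn_below hT _) (by simp)).clm_apply
    (continuousOn_const (c := ((0 : EuclideanSpace ℝ (Fin n)), (1 : ℝ))))).congr fun p hp => ?_
  exact (h.hasDerivWithinAt_time hp).derivWithin
    ((uniqueDiffOn_timeInterval hT) _ (h.mem_timeInterval hp.1))

lemma continuousOn_areaElement (h : IsLocalGraphicalFlow α a T Ω u) (hT : 0 < T) :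
    ContinuousOn (fun p : EuclideanSpace ℝ (Fin n) × ℝ => areaElement (fun y => u y p.2) p.1)
      (below Ω u (a + 1)) := by
  have hc := fun i : Fin n =>
    (h.smooth.continuousOn_fderivWithin (h.uniqueDiffOn_below hT _) (by simp)).clm_apply
    (continuousOn_const (c := ((EuclideanSpace.single i 1 : EuclideanSpace ℝ (Fin n)), (0 : ℝ))))
  refine ((continuousOn_const (c := (1 : ℝ))).add
    (continuousOn_finsetSum Finset.univ fun i _ => (hc i).pow 2)).sqrt.congr fun p hp => ?_
  rw [areaElement_eq_sqrt, (h.hasFDerivAt_slice hp).fderiv]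
  rfl

lemma meanCurvature_eq (h : IsLocalGraphicalFlow α a T Ω u) (hα : 0 < α)
    {p : EuclideanSpace ℝ (Fin n) × ℝ} (hp : p ∈ below Ω u (a + 1)) :
    meanCurvature (fun y => u y p.2) p.1
      = (derivWithin (fun s => u p.1 s) (timeInterval T) p.2
        / areaElement (fun y => u y p.2) p.1) ^ α⁻¹ := by
  rw [h.flow p hp, ← Real.rpow_mul (h.meanConvex p hp).le, mul_inv_cancel₀ hα.ne', Real.rpow_one]

/-- The flow equation expresses `H` through first derivatives of `u`, so its continuity up to the
initial time needs no second derivatives. -/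
lemma continuousOn_meanCurvature (h : IsLocalGraphicalFlow α a T Ω u) (hα : 0 < α) (hT : 0 < T) :
    ContinuousOn (fun p : EuclideanSpace ℝ (Fin n) × ℝ => meanCurvature (fun y => u y p.2) p.1)
      (below Ω u (a + 1)) := by
  refine (((h.continuousOn_derivWithin hT).div (h.continuousOn_areaElement hT) fun p _ => ?_).rpow_const
    fun p _ => Or.inr (inv_nonneg.2 hα.le)).congr fun p hp => h.meanCurvature_eq hα hp
  linarith [one_le_areaElement (fun y => u y p.2) p.1]

/-- The graph moves upwards, so the parts of height at most `a` come from such parts at all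
earlier times. -/
lemma sublevel_of_le (h : IsLocalGraphicalFlow α a T Ω u) {x : EuclideanSpace ℝ (Fin n)} {t : ℝ}
    (hp : (x, t) ∈ Ω) (hu : u x t ≤ a) {s : ℝ} (hs : s ∈ Set.Icc 0 t) :
    (x, s) ∈ Ω ∧ u x s ≤ a := by
  have ht : t ∈ timeInterval T := h.mem_timeInterval hp
  have hIcc : ∀ s ∈ Set.Icc 0 t, s ∈ timeInterval T := fun s hs =>
    ⟨hs.1, lt_of_le_of_lt (EReal.coe_le_coe_iff.2 hs.2) ht.2⟩
  obtain ⟨K, hK, hKe⟩ := h.relClosed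
  have hmem : ∀ s ∈ Set.Icc 0 t, ((x, s) ∈ Ω ∧ u x s ≤ a) ↔ (x, s) ∈ K := fun s hs => by
    have := Set.ext_iff.1 hKe (x, s)
    exact this.trans ⟨fun h => h.1, fun h => ⟨h, trivial, hIcc s hs⟩⟩
  have hclosed : IsClosed ({s : ℝ | (x, s) ∈ Ω ∧ u x s ≤ a} ∩ Set.Icc 0 t) := by
    have : {s : ℝ | (x, s) ∈ Ω ∧ u x s ≤ a} ∩ Set.Icc 0 t
        = (fun s : ℝ => (x, s)) ⁻¹' K ∩ Set.Icc 0 t := by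
      ext s
      exact and_congr_left fun hs => hmem s hs
    rw [this]
    exact (hK.preimage (by fun_prop)).inter isClosed_Icc
  -- Continuous induction backwards from `t`. The set of times with `u ≤ a` is closed by
  -- `relClosed`, and from any positive time in it `∂ₜu > 0` leads to slightly earlier ones.
  refine hclosed.Icc_subset_of_forall_exists_lt ⟨hp, hu⟩ ?_ hs
  rintro r ⟨⟨hr, hra⟩, hr0, hrt⟩ y hy
  have hrB : (x, r) ∈ below Ω u (a + 1) := ⟨hr, by simpa using lt_of_le_of_lt hra (lt_add_one a)⟩
  have hrI := h.mem_timeInterval hr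
  have hd : HasDerivAt (fun s => u x s) (derivWithin (fun s => u x s) (timeInterval T) r) r :=
    ((h.hasDerivWithinAt_time hrB).differentiableWithinAt.hasDerivWithinAt).hasDerivAt
      (timeInterval_mem_nhds hrI hr0)
  have hpos := h.derivWithin_pos hrB
  have hlt : ∀ᶠ s in 𝓝[<] r, u x s < u x r := by
    have := (hasDerivWithinAt_iff_tendsto_slope' (by simp)).1 (hd.hasDerivWithinAt (s := Set.Iio r))
    filter_upwards [this.eventually_const_lt hpos, self_mem_nhdsWithin] with s hs hsr
    rw [slope_def_field] at hs
    have hsr' : s - r < 0 := sub_neg.2 hsr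
    by_contra! hcon
    exact absurd hs (not_lt.2 (div_nonpos_of_nonneg_of_nonpos (by linarith) hsr'.le))
  have hΩ : ∀ᶠ s in 𝓝[<] r, (x, s) ∈ below Ω u (a + 1) := by
    have hc : ContinuousAt (fun s : ℝ => (x, s)) r := by fun_prop
    exact nhdsWithin_le_nhds (hc.eventually (h.below_mem_nhds hrB hr0))
  have hy' : ∀ᶠ s in 𝓝[<] r, y < s := nhdsWithin_le_nhds (lt_mem_nhds hy)
  obtain ⟨s, ⟨hs1, hs2, hs3⟩, hs4⟩ :=
    ((hlt.and (hΩ.and hy')).and self_mem_nhdsWithin).exists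
  exact ⟨s, ⟨hs2.1, hs1.le.trans hra⟩, hs3.le, hs4⟩

/-- By monotonicity in time the set is contained in `{u(·, 0) ≤ a} × [0, t]`, and it is closed by
`relClosed`. -/
lemma isCompact_sublevel (h : IsLocalGraphicalFlow α a T Ω u) (hT : 0 < T) {t : ℝ}
    (ht : t ∈ timeInterval T) :
    IsCompact {p : EuclideanSpace ℝ (Fin n) × ℝ | (p ∈ Ω ∧ u p.1 p.2 ≤ a) ∧ p.2 ≤ t} := by
  have h0 : (0 : ℝ) ∈ timeInterval T := ⟨le_rfl, by exact_mod_cast hT⟩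
  obtain ⟨K, hK, hKe⟩ := h.relClosed
  have he : {p : EuclideanSpace ℝ (Fin n) × ℝ | (p ∈ Ω ∧ u p.1 p.2 ≤ a) ∧ p.2 ≤ t}
      = K ∩ (Set.univ ×ˢ Set.Icc 0 t) := by
    ext p
    have := Set.ext_iff.1 hKe p
    constructor
    · rintro ⟨hp, hpt⟩
      have hpK := this.1 hp
      exact ⟨hpK.1, trivial, hpK.2.2.1, hpt⟩
    · rintro ⟨hp, -, hp0, hpt⟩
      exact ⟨this.2 ⟨hp, trivial, hp0, lt_of_le_of_lt (EReal.coe_le_coe_iff.2 hpt) ht.2⟩, hpt⟩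
  refine ((h.compact_slice 0 h0).prod (isCompact_Icc (a := (0 : ℝ)) (b := t))).of_isClosed_subset
    ?_ ?_
  · rw [he]
    exact hK.inter (isClosed_univ.prod isClosed_Icc)
  · rintro p ⟨⟨hp, hpa⟩, hpt⟩
    have hp0 : 0 ≤ p.2 := (h.mem_timeInterval hp).1
    exact ⟨h.sublevel_of_le hp hpa ⟨le_rfl, hp0⟩, hp0, hpt⟩

/-- The flow equation in coordinates, solved for the mean curvature. -/
lemma exists_smooth_extension (h : IsLocalGraphicalFlow α a T Ω u) (hα : 0 < α)
    {p : EuclideanSpace ℝ (Fin n) × ℝ} (hp : p ∈ below Ω u (a + 1)) (h0 : 0 < p.2) :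
    ∃ f : EuclideanSpace ℝ (Fin n) × ℝ → ℝ, ContDiff ℝ ∞ f ∧ ∀ᶠ z in 𝓝 p,
      z ∈ below Ω u (a + 1) ∧ f z = u z.1 z.2 ∧
      areaElement (fun y => u y z.2) z.1 = √(areaSq f z) ∧
      derivWithin (fun s => u z.1 s) (timeInterval T) z.2 = dirDeriv timeDir f z ∧
      areaSq f z * (spaceHess f z).trace - spaceGrad f z ⬝ᵥ spaceHess f z *ᵥ spaceGrad f z
        = areaSq f z ^ ((3 - α⁻¹) / 2) * dirDeriv timeDir f z ^ α⁻¹ := by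
  obtain ⟨f, hf, hfu⟩ := exists_contDiff_eventuallyEq isOpen_interior
    (h.smooth.mono interior_subset) (mem_interior_iff_mem_nhds.2 (h.below_mem_nhds hp h0))
  refine ⟨f, hf, ?_⟩
  have hpos : ∀ᶠ z : EuclideanSpace ℝ (Fin n) × ℝ in 𝓝 p, 0 < z.2 :=
    continuous_snd.continuousAt.eventually_const_lt h0
  filter_upwards [h.below_mem_nhds hp h0, hfu.eventuallyEq_nhds, hpos] with z hz hfz hz0
  have hslice : (fun y => u y z.2) =ᶠ[𝓝 z.1] fun y => f (y, z.2) := by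
    have hc : ContinuousAt (fun y : EuclideanSpace ℝ (Fin n) => (y, z.2)) z.1 := by fun_prop
    exact (hc.eventually hfz).mono fun y hy => hy.symm
  have hA : areaElement (fun y => u y z.2) z.1 = √(areaSq f z) := by
    rw [areaElement_congr hslice, areaElement_slice hf]
  have hφ : derivWithin (fun s => u z.1 s) (timeInterval T) z.2 = dirDeriv timeDir f z := by
    rw [derivWithin_of_mem_nhds (timeInterval_mem_nhds (h.mem_timeInterval hz.1) hz0)]
    have h1 : HasDerivAt (fun s : ℝ => f (z.1, s)) (dirDeriv timeDir f z) z.2 :=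
      ((hf.differentiable (by simp)) z).hasFDerivAt.comp_hasDerivAt z.2
        ((hasDerivAt_const z.2 z.1).prodMk (hasDerivAt_id z.2))
    have hc : ContinuousAt (fun s : ℝ => (z.1, s)) z.2 := by fun_prop
    exact (h1.congr_of_eventuallyEq ((hc.eventually hfz).mono fun y hy => hy.symm)).deriv
  refine ⟨hz, hfz.self_of_nhds, hA, hφ, ?_⟩
  have hP : 0 < areaSq f z := by linarith [one_le_areaSq (f := f) z]
  have hH := meanCurvature_slice hf z.2 z.1
  rw [← meanCurvature_congr hslice, h.meanCurvature_eq hα hz, hA, hφ] at hH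
  refine hH.symm.trans ?_
  have hφ0 : 0 < dirDeriv timeDir f z := hφ ▸ h.derivWithin_pos hz
  -- With `v = P^(1/2)` and `β = α⁻¹`, this is `v³ (φ/v)^β = P^((3-β)/2) φ^β`.
  rw [Real.div_rpow hφ0.le (Real.sqrt_nonneg _), Real.sqrt_eq_rpow, ← Real.rpow_natCast,
    ← Real.rpow_mul hP.le, ← Real.rpow_mul hP.le, mul_div_assoc', mul_div_right_comm,
    ← Real.rpow_sub hP]
  congr 2
  push_cast; ring

end IsLocalGraphicalFlow

/-! ### The test function and its maximum. -/

section TestFunction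

variable {n : ℕ} {α a c : ℝ} {T : EReal} {Ω : Set (EuclideanSpace ℝ (Fin n) × ℝ)}
  {u : EuclideanSpace ℝ (Fin n) → ℝ → ℝ}

lemma mem_below_of_cutoff_pos {p : EuclideanSpace ℝ (Fin n) × ℝ} (hp : p ∈ Ω)
    (hψ : 0 < cutoff a u p.1 p.2) : p ∈ below Ω u a := by
  refine ⟨hp, ?_⟩
  rcases lt_max_iff.1 hψ with h | h
  · linarith
  · exact absurd h (lt_irrefl _)

lemma cutoff_eq {x : EuclideanSpace ℝ (Fin n)} {t : ℝ} (hu : u x t ≤ a) :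
    cutoff a u x t = a - u x t :=
  max_eq_left (by linarith)

lemma below_subset (Ω : Set (EuclideanSpace ℝ (Fin n) × ℝ))
    (u : EuclideanSpace ℝ (Fin n) → ℝ → ℝ) {b d : ℝ} (hbd : b ≤ d) :
    below Ω u b ⊆ below Ω u d := fun _ hp => ⟨hp.1, hp.2.trans_le hbd⟩

lemma sublevel_subset (Ω : Set (EuclideanSpace ℝ (Fin n) × ℝ))
    (u : EuclideanSpace ℝ (Fin n) → ℝ → ℝ) {p : EuclideanSpace ℝ (Fin n) × ℝ} (hp : p ∈ Ω)
    (hu : u p.1 p.2 ≤ a) : p ∈ below Ω u (a + 1) := ⟨hp, hu.trans_lt (lt_add_one a)⟩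

/-- The test function `ψ ^ α ∂ₜu / (1 - c / w)`, with a denominator that is bounded from below. -/
noncomputable def testFunction (α a c : ℝ) (T : EReal) (u : EuclideanSpace ℝ (Fin n) → ℝ → ℝ)
    (p : EuclideanSpace ℝ (Fin n) × ℝ) : ℝ :=
  cutoff a u p.1 p.2 ^ α * derivWithin (fun s => u p.1 s) (timeInterval T) p.2
    / max (1 - c * areaElement (fun y => u y p.2) p.1) (1 / 2)

lemma two_mul_areaElement_le (hw : ∀ p ∈ Ω, 0 < cutoff a u p.1 p.2 →
      2 * c ≤ normalHeight (fun y => u y p.2) p.1)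
    {p : EuclideanSpace ℝ (Fin n) × ℝ} (hp : p ∈ Ω) (hψ : 0 < cutoff a u p.1 p.2) :
    2 * (c * areaElement (fun y => u y p.2) p.1) ≤ 1 := by
  have hA : 0 < areaElement (fun y => u y p.2) p.1 := by
    linarith [one_le_areaElement (fun y => u y p.2) p.1]
  have := hw p hp hψ
  rw [normalHeight, le_div_iff₀ hA] at this
  linarith

/-- The truncation of the denominator at `1/2` is inactive where `ψ > 0`. It serves only the
continuity of the test function at points with `ψ = 0`, where no gradient bound is assumed. -/
lemma testFunction_eq (hw : ∀ p ∈ Ω, 0 < cutoff a u p.1 p.2 →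
      2 * c ≤ normalHeight (fun y => u y p.2) p.1)
    {p : EuclideanSpace ℝ (Fin n) × ℝ} (hp : p ∈ Ω) (hψ : 0 < cutoff a u p.1 p.2) :
    testFunction α a c T u p = cutoff a u p.1 p.2 ^ α
      * derivWithin (fun s => u p.1 s) (timeInterval T) p.2
      / (1 - c * areaElement (fun y => u y p.2) p.1) := by
  rw [testFunction, max_eq_left]
  linarith [two_mul_areaElement_le hw hp hψ]

end TestFunction

namespace IsLocalGraphicalFlow

variable {n : ℕ} {α a c : ℝ} {T : EReal} {Ω : Set (EuclideanSpace ℝ (Fin n) × ℝ)}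
  {u : EuclideanSpace ℝ (Fin n) → ℝ → ℝ}

lemma continuousOn_cutoff (h : IsLocalGraphicalFlow α a T Ω u) :
    ContinuousOn (fun p : EuclideanSpace ℝ (Fin n) × ℝ => cutoff a u p.1 p.2) Ω :=
  ContinuousOn.sup (continuousOn_const.sub h.continuousOn) continuousOn_const

/-- Only the compact part `u ≤ a` of the initial slice matters, because `ψ` vanishes elsewhere. -/
lemma bddAbove_initial (h : IsLocalGraphicalFlow α a T Ω u) (hα : 0 < α) (hT : 0 < T) :
    BddAbove ((fun x => cutoff a u x 0 * meanCurvature (fun y => u y 0) x) ''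
      {x | (x, (0 : ℝ)) ∈ Ω}) := by
  have h0 : (0 : ℝ) ∈ timeInterval T := ⟨le_rfl, by exact_mod_cast hT⟩
  have hcont : ContinuousOn (fun p : EuclideanSpace ℝ (Fin n) × ℝ =>
      cutoff a u p.1 p.2 * meanCurvature (fun y => u y p.2) p.1) (below Ω u (a + 1)) :=
    (h.continuousOn_cutoff.mono fun p hp => hp.1).mul (h.continuousOn_meanCurvature hα hT)
  obtain ⟨M, hM⟩ := (h.isCompact_sublevel hT h0).bddAbove_image
    (hcont.mono fun p hp => sublevel_subset Ω u hp.1.1 hp.1.2)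
  refine ⟨max M 0, ?_⟩
  rintro _ ⟨x, hx, rfl⟩
  by_cases hxa : u x 0 ≤ a
  · exact le_max_of_le_left (hM ⟨(x, 0), ⟨⟨hx, hxa⟩, le_rfl⟩, rfl⟩)
  · refine le_max_of_le_right (le_of_eq ?_)
    have : cutoff a u x 0 = 0 := max_eq_right (by linarith)
    simp [this]

lemma continuousOn_testFunction (h : IsLocalGraphicalFlow α a T Ω u) (hα : 0 < α) (hT : 0 < T) :
    ContinuousOn (testFunction α a c T u) (below Ω u (a + 1)) := by
  refine (((h.continuousOn_cutoff.mono fun p hp => hp.1).rpow_const fun _ _ =>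
    Or.inr hα.le).mul (h.continuousOn_derivWithin hT)).div
    (ContinuousOn.sup (continuousOn_const.sub
      (continuousOn_const.mul (h.continuousOn_areaElement hT))) continuousOn_const) fun p _ => ?_
  exact (lt_max_of_lt_right (by norm_num)).ne'

lemma log_testFunction (h : IsLocalGraphicalFlow α a T Ω u)
    (hw : ∀ p ∈ Ω, 0 < cutoff a u p.1 p.2 → 2 * c ≤ normalHeight (fun y => u y p.2) p.1)
    {p : EuclideanSpace ℝ (Fin n) × ℝ} (hp : p ∈ below Ω u a) :
    0 < testFunction α a c T u p ∧ Real.log (testFunction α a c T u p)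
      = α * Real.log (a - u p.1 p.2)
        + Real.log (derivWithin (fun s => u p.1 s) (timeInterval T) p.2)
        - Real.log (1 - c * areaElement (fun y => u y p.2) p.1) := by
  have hψ : cutoff a u p.1 p.2 = a - u p.1 p.2 := cutoff_eq hp.2.le
  have hpos : 0 < a - u p.1 p.2 := sub_pos.2 hp.2
  have hd := h.derivWithin_pos (below_subset Ω u (by linarith) hp)
  have hv := two_mul_areaElement_le hw hp.1 (by rwa [hψ])
  have hm : 0 < 1 - c * areaElement (fun y => u y p.2) p.1 := by linarith
  rw [testFunction_eq hw hp.1 (by rwa [hψ]), hψ]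
  have hpow := Real.rpow_pos_of_pos hpos α
  refine ⟨by positivity, ?_⟩
  rw [Real.log_div (mul_pos hpow hd).ne' hm.ne', Real.log_mul hpow.ne' hd.ne',
    Real.log_rpow hpos]

/-- Two-sided comparison of the test function with `(ψ H) ^ α`. -/
lemma testFunction_bounds (h : IsLocalGraphicalFlow α a T Ω u) (hc : 0 < c)
    (hw : ∀ p ∈ Ω, 0 < cutoff a u p.1 p.2 → 2 * c ≤ normalHeight (fun y => u y p.2) p.1)
    {p : EuclideanSpace ℝ (Fin n) × ℝ} (hp : p ∈ below Ω u a) :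
    (cutoff a u p.1 p.2 * meanCurvature (fun y => u y p.2) p.1) ^ α ≤ testFunction α a c T u p ∧
    testFunction α a c T u p
      ≤ (cutoff a u p.1 p.2 * meanCurvature (fun y => u y p.2) p.1) ^ α / c := by
  have hψ : 0 < cutoff a u p.1 p.2 := lt_max_of_lt_left (sub_pos.2 hp.2)
  have hpB := below_subset Ω u (show a ≤ a + 1 by linarith) hp
  have hH := h.meanConvex p hpB
  have hv := two_mul_areaElement_le hw hp.1 hψ
  have hv1 := one_le_areaElement (fun y => u y p.2) p.1
  rw [testFunction_eq hw hp.1 hψ, h.derivWithin_eq hpB, Real.mul_rpow hψ.le hH.le]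
  set v := areaElement (fun y => u y p.2) p.1
  have hm : 0 < 1 - c * v := by linarith
  have hX : 0 < cutoff a u p.1 p.2 ^ α * meanCurvature (fun y => u y p.2) p.1 ^ α := by positivity
  have e : cutoff a u p.1 p.2 ^ α * (v * meanCurvature (fun y => u y p.2) p.1 ^ α) / (1 - c * v)
      = (cutoff a u p.1 p.2 ^ α * meanCurvature (fun y => u y p.2) p.1 ^ α) * (v / (1 - c * v)) := by
    ring
  rw [e]
  -- It remains to see `1 ≤ v / (1 - c v) ≤ 1/c`, which follows from `v ≥ 1` and `2 c v ≤ 1`.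
  constructor
  · refine le_mul_of_one_le_right hX.le ?_
    rw [one_le_div hm]
    nlinarith
  · rw [div_eq_mul_inv _ c, ← one_div]
    refine mul_le_mul_of_nonneg_left ?_ hX.le
    rw [div_le_div_iff₀ hm hc]
    linarith

/-- At a maximum of the test function at a positive time, `ψ H` is bounded. -/
lemma cutoff_mul_meanCurvature_le (h : IsLocalGraphicalFlow α a T Ω u) (hα : 0 < α) (hc : 0 < c)
    (hw : ∀ p ∈ Ω, 0 < cutoff a u p.1 p.2 → 2 * c ≤ normalHeight (fun y => u y p.2) p.1)
    {q : EuclideanSpace ℝ (Fin n) × ℝ} (hq : q ∈ below Ω u a) (h0 : 0 < q.2)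
    (hmax : ∀ z ∈ below Ω u a, z.2 ≤ q.2 → testFunction α a c T u z ≤ testFunction α a c T u q) :
    cutoff a u q.1 q.2 * meanCurvature (fun y => u y q.2) q.1 ≤ curvatureBound n α c := by
  have hqB := below_subset Ω u (show a ≤ a + 1 by linarith) hq
  obtain ⟨f, hf, hev⟩ := h.exists_smooth_extension hα hqB h0
  obtain ⟨-, hfq, hAq, hφq, -⟩ := hev.self_of_nhds
  have hψ : cutoff a u q.1 q.2 = a - f q := by rw [cutoff_eq hq.2.le, hfq]
  rw [hψ]
  refine mul_curvature_le_of_interior_max hα hc hf (by rw [hfq]; exact hq.2) ?_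
    (h.meanConvex q hqB) ?_ (hev.mono fun z hz => hz.2.2.2.2) ?_
  · rw [← hAq]
    exact two_mul_areaElement_le hw hq.1 (lt_max_of_lt_left (sub_pos.2 hq.2))
  · rw [← hφq, ← hAq, h.derivWithin_eq hqB]
  · filter_upwards [hev, h.below_mem_nhds hq h0] with z hz hza hzt
    obtain ⟨-, hfz, hAz, hφz, -⟩ := hz
    have hlz := h.log_testFunction hw hza
    have hlq := h.log_testFunction hw hq
    rw [hfq, hfz, ← hAq, ← hAz, ← hφq, ← hφz, ← hlz.2, ← hlq.2]
    exact Real.log_le_log hlz.1 (hmax z hza hzt)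

end IsLocalGraphicalFlow

/-! ### Conclusion by the maximum principle. -/

theorem mainTheorem5 (n : ℕ) (α a wlow : ℝ) (hα : 0 < α) (hw : 0 < wlow) :
    ∃ C : ℝ, 0 < C ∧
      ∀ (T : EReal) (Ω : Set (EuclideanSpace ℝ (Fin n) × ℝ))
        (u : EuclideanSpace ℝ (Fin n) → ℝ → ℝ),
        0 < T →
        IsLocalGraphicalFlow α a T Ω u →
        (∀ p ∈ Ω, 0 < cutoff a u p.1 p.2 →
          2 * wlow ≤ normalHeight (fun y => u y p.2) p.1) →
        BddAbove ((fun x => cutoff a u x 0 * meanCurvature (fun y => u y 0) x) ''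
          {x | (x, (0 : ℝ)) ∈ Ω}) ∧
        ∀ p ∈ Ω, cutoff a u p.1 p.2 * meanCurvature (fun y => u y p.2) p.1 ≤
          C * max (sSup ((fun x => cutoff a u x 0 * meanCurvature (fun y => u y 0) x) ''
            {x | (x, (0 : ℝ)) ∈ Ω})) 1 := by
  have hK1 : 0 < max (curvatureBound n α wlow) 1 := lt_max_of_lt_right one_pos
  have hw1 : 0 < (wlow ^ α⁻¹)⁻¹ := by positivity
  -- The factor `wlow^(-1/α)` is the loss in comparing `F` with `(ψ H)^α`, after taking the root.
  -- The maximum with `1` covers a maximum point at time zero.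
  refine ⟨(wlow ^ α⁻¹)⁻¹ * max (curvatureBound n α wlow) 1, mul_pos hw1 hK1, ?_⟩
  intro T Ω u hT h hn
  have hbdd := h.bddAbove_initial hα hT
  refine ⟨hbdd, fun p hp => ?_⟩
  set S := sSup ((fun x => cutoff a u x 0 * meanCurvature (fun y => u y 0) x) ''
    {x | (x, (0 : ℝ)) ∈ Ω})
  have hS1 : 1 ≤ max S 1 := le_max_right _ _
  have hψ' : 0 ≤ cutoff a u p.1 p.2 := le_max_right _ _
  rcases hψ'.eq_or_lt with hψ0 | hψ
  · rw [← hψ0, zero_mul]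
    positivity
  have hpa := mem_below_of_cutoff_pos hp hψ
  obtain ⟨q, ⟨⟨hqΩ, hqa⟩, hqt⟩, hqmax⟩ := (h.isCompact_sublevel hT
    (h.mem_timeInterval hp)).exists_isMaxOn ⟨p, ⟨⟨hp, hpa.2.le⟩, le_rfl⟩⟩
    ((h.continuousOn_testFunction (c := wlow) hα hT).mono
      fun z hz => sublevel_subset Ω u hz.1.1 hz.1.2)
  have hpq : testFunction α a wlow T u p ≤ testFunction α a wlow T u q :=
    hqmax ⟨⟨hp, hpa.2.le⟩, le_rfl⟩
  have hq : q ∈ below Ω u a := by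
    refine ⟨hqΩ, lt_of_le_of_ne hqa fun he => ?_⟩
    -- On `u = a` the cut-off vanishes, and `0 ^ α = 0` because `α > 0`, whereas `F` is positive at
    -- `p`.
    have h0 : testFunction α a wlow T u q = 0 := by
      rw [testFunction, cutoff_eq hqa, he, sub_self, Real.zero_rpow hα.ne', zero_mul, zero_div]
    linarith [(h.log_testFunction hn hpa).1]
  have hqB := below_subset Ω u (show a ≤ a + 1 by linarith) hq
  have hX0 : 0 < cutoff a u q.1 q.2 * meanCurvature (fun y => u y q.2) q.1 :=
    mul_pos (lt_max_of_lt_left (sub_pos.2 hq.2)) (h.meanConvex q hqB)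
  have hX : cutoff a u q.1 q.2 * meanCurvature (fun y => u y q.2) q.1
      ≤ max (curvatureBound n α wlow) 1 * max S 1 := by
    rcases (h.mem_timeInterval hqΩ).1.eq_or_lt with hq0 | hq0
    · obtain ⟨x, t⟩ := q
      obtain rfl : 0 = t := hq0
      have : cutoff a u x 0 * meanCurvature (fun y => u y 0) x ≤ S :=
        le_csSup hbdd ⟨x, hqΩ, rfl⟩
      refine (this.trans (le_max_left S 1)).trans ?_
      exact le_mul_of_one_le_left (by linarith) (le_max_right _ _)
    · refine (h.cutoff_mul_meanCurvature_le hα hw hn hq hq0 fun z hz hzt => ?_).trans ?_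
      · exact hqmax ⟨⟨hz.1, hz.2.le⟩, hzt.trans hqt⟩
      · exact (le_max_left _ _).trans (le_mul_of_one_le_right hK1.le hS1)
  have hY0 : 0 < cutoff a u p.1 p.2 * meanCurvature (fun y => u y p.2) p.1 :=
    mul_pos hψ (h.meanConvex p (below_subset Ω u (by linarith) hpa))
  -- `(ψ H)^α (p) ≤ F(p) ≤ F(q) ≤ (ψ H)^α (q) / wlow`, followed by the bound at `q`.
  have hchain : (cutoff a u p.1 p.2 * meanCurvature (fun y => u y p.2) p.1) ^ α
      ≤ (max (curvatureBound n α wlow) 1 * max S 1) ^ α / wlow :=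
    ((h.testFunction_bounds hw hn hpa).1.trans hpq).trans
      ((h.testFunction_bounds hw hn hq).2.trans (by gcongr))
  have hroot := Real.rpow_le_rpow (by positivity) hchain (inv_nonneg.2 hα.le)
  rw [← Real.rpow_mul hY0.le, mul_inv_cancel₀ hα.ne', Real.rpow_one,
    Real.div_rpow (by positivity) hw.le, ← Real.rpow_mul (by positivity), mul_inv_cancel₀ hα.ne',
    Real.rpow_one] at hroot
  refine hroot.trans (le_of_eq ?_)
  rw [div_eq_inv_mul, mul_assoc]
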